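/- **Conventions.** Let $V$ be a positive definite ternary quadratic space over $\mathbb Q$, with quadratic form $Q$ and bilinear form $B$, $B(x,x)=Q(x)$. A $\mathbb Z$-lattice on $V$ is a finitely generated subgroup spanning $V$; it is (non-classic) integral if $Q(x)\in\mathbb Z$ for all its elements $x$. Write $V_p=\mathbb Q_p\otimes V$, $L_p=\mathbb Z_pL\subset V_p$. Let $O'(V_p)$ be the group of rotations of $V_p$ with trivial spinor norm, i.e. of products $\tau_{v_1}\cdots\tau_{v_r}$ of symmetries in anisotropic vectors, $r$ even, with $Q(v_1)\cdots Q(v_r)\in(\mathbb Q_p^\times)^2$. For a lattice $L$ on $V$: the class $[L]$ is the set of all $\sigma L$, $\sigma\in O(V)$; $\mathrm{gen}(L)$ is the set of lattices $K$ on $V$ such that for every prime $p$, $K_p=\Sigma_pL_p$ for some $\Sigma_p\in O(V_p)$; $\mathrm{spn}(L)$ is the set of lattices $K$ on $V$ for which there is $\sigma\in O(V)$ such that for every prime $p$, $K_p=\sigma\Sigma_pL_p$ for some $\Sigma_p\in O'(V_p)$; $g(L)$ is the number of spinor genera in $\mathrm{gen}(L)$. Let $n$ be a positive integer, and let $M$,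 $N$ be integral $\mathbb Z$-lattices on positive definite ternary quadratic spaces $V$, $W$ over $\mathbb Q$. Denote by $M^n$ the lattice $M$ with its form multiplied by $n$. The pair $([N],[M])$ is *a representable pair by scaling $n$* if there is a representation (form-preserving linear map) $\phi:M^n\to N$ with $[N:\phi(M^n)]=n$. A *genus-correspondence* between $\mathrm{gen}(N)$ and $\mathrm{gen}(M)$ is a set $\mathfrak C$ of pairs $([N_1],[M_1])$ with $N_1\in\mathrm{gen}(N)$, $M_1\in\mathrm{gen}(M)$, each a representable pair by scaling $n$, such that for every $N'\in\mathrm{gen}(N)$ there is $M'\in\mathrm{gen}(M)$ with $([N'],[M'])\in\mathfrak C$, and for every $M'\in\mathrm{gen}(M)$ there is $N'\in\mathrm{gen}(N)$ with $([N'],[M'])\in\mathfrak C$. It *respects spinor genus* if for any two pairs $([N_1],[M_1]),([N_2],[M_2])\in\mathfrak C$ one has $N_1\in\mathrm{spn}(N_2)$ if and only if $M_1\in\mathrm{spn}(M_2)$. **Theorem 4.4.** Let $n$ be any positive integer (not necessarily square-free), and let $N$ and $M$ be integral $\mathbb Z$-lattices on positive definite ternary quadratic spaces over $\mathbb Q$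 such that $([N],[M])$ is a representable pair by scaling $n$. If $g(N)=g(M)$, then there is a genus-correspondence between $\mathrm{gen}(N)$ and $\mathrm{gen}(M)$ (by scaling $n$) that respects spinor genus. -/

import Mathlib

open scoped TensorProduct

noncomputable section

namespace SpinorGenus

section General

variable {K : Type*} [Field K] {U : Type*} [AddCommGroup U] [Module K U]

/-- The symmetry `τ_v : x ↦ x - (2 B(x, v) / Q(v)) v` in the hyperplane orthogonal to `v`
(meaningful when `Q v ≠ 0`); here `B` is normalized by `B(x, x) = Q(x)`, so that
`2 B(x, v)` is the polar form `Q(x + v) - Q(x) - Q(v)`. -/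
def symmetryAt (Q : QuadraticForm K U) (v : U) : Module.End K U :=
  LinearMap.id - (Q v)⁻¹ • (Q.polarBilin v).smulRight v

/-- `σ` is a rotation of the quadratic space `(U, Q)` whose spinor norm is the square class of
`c`: `σ = τ_{v₁} ⋯ τ_{v_r}` for anisotropic vectors `v₁, …, v_r` with `r` even (so that
`det σ = 1`) and `c = Q(v₁) ⋯ Q(v_r)`.  On a nondegenerate space over a field of
characteristic not two every rotation is such a product, and the square class of `c` does not
depend on the product chosen. -/
def HasSpinorNorm (Q : QuadraticForm K U) (σ : Q.IsometryEquiv Q) (c : K) : Prop :=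
  ∃ l : List U, Even l.length ∧ (∀ v ∈ l, Q v ≠ 0) ∧
    (l.map (symmetryAt Q)).prod = σ.toLinearEquiv.toLinearMap ∧ (l.map Q).prod = c

/-- The spinorial kernel `O'(U)`: the rotations whose spinor norm is the trivial square class. -/
def spinorKernel (Q : QuadraticForm K U) : Set (Q.IsometryEquiv Q) :=
  {σ | ∃ c : K, IsSquare c ∧ HasSpinorNorm Q σ c}

end General

variable {V : Type*} [AddCommGroup V] [Module ℚ V]
variable {W : Type*} [AddCommGroup W] [Module ℚ W]

/-- `L` is a non-classic integral `ℤ`-lattice on the quadratic space `(V, Q)`: it is finitely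
generated, spans `V`, and its norm ideal (generated by the `Q x`, `x ∈ L`) lies in `ℤ`. -/
structure IsIntegralLattice (Q : QuadraticForm ℚ V) (L : Submodule ℤ V) : Prop where
  isLattice : Submodule.IsLattice ℚ L
  integral : ∀ x ∈ L, ∃ m : ℤ, Q x = m

/-- The localization `V_p = ℚ_p ⊗ V` of the quadratic space `(V, Q)`: its quadratic form. -/
abbrev localForm (p : ℕ) [Fact p.Prime] (Q : QuadraticForm ℚ V) :
    QuadraticForm ℚ_[p] (ℚ_[p] ⊗[ℚ] V) :=
  QuadraticForm.baseChange ℚ_[p] Q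

/-- The localization `L_p = ℤ_p L ⊆ V_p` of a `ℤ`-lattice `L` on `V`. -/
def localLattice (p : ℕ) [Fact p.Prime] (L : Submodule ℤ V) :
    Submodule ℤ_[p] (ℚ_[p] ⊗[ℚ] V) :=
  Submodule.span ℤ_[p] ((fun x : V => (1 : ℚ_[p]) ⊗ₜ[ℚ] x) '' (L : Set V))

/-- The class `[L]`: all lattices `σ L` with `σ ∈ O(V)`. -/
def cls (Q : QuadraticForm ℚ V) (L : Submodule ℤ V) : Set (Submodule ℤ V) :=
  {K | ∃ σ : Q.IsometryEquiv Q, (K : Set V) = σ '' (L : Set V)}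

/-- The genus `gen(L)`: all lattices `K` on `V` such that for every prime `p` there is
`Σ_p ∈ O(V_p)` with `K_p = Σ_p L_p`. -/
def gen (Q : QuadraticForm ℚ V) (L : Submodule ℤ V) : Set (Submodule ℤ V) :=
  {K | Submodule.IsLattice ℚ K ∧ ∀ (p : ℕ) [Fact p.Prime],
    ∃ S : (localForm p Q).IsometryEquiv (localForm p Q),
      (localLattice p K : Set (ℚ_[p] ⊗[ℚ] V)) = S '' (localLattice p L : Set (ℚ_[p] ⊗[ℚ] V))}

/-- The spinor genus `spn(L)`: all lattices `K` on `V` of the form `K = σ Σ L`, with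
`σ ∈ O(V)` and `Σ = (Σ_p)`, `Σ_p ∈ O'(V_p)`; that is, `K_p = σ_p Σ_p L_p` for every prime `p`.
(As `K` and `L` are lattices, `Σ_p L_p = L_p` for almost all `p` automatically.  In odd
dimension this is also the proper spinor genus, because `-1` fixes every lattice.) -/
def spn (Q : QuadraticForm ℚ V) (L : Submodule ℤ V) : Set (Submodule ℤ V) :=
  {K | Submodule.IsLattice ℚ K ∧ ∃ σ : Q.IsometryEquiv Q, ∀ (p : ℕ) [Fact p.Prime],
    ∃ S ∈ spinorKernel (localForm p Q),
      (localLattice p K : Set (ℚ_[p] ⊗[ℚ] V)) =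
        (σ.toLinearEquiv.toLinearMap.baseChange ℚ_[p]) ''
          (S '' (localLattice p L : Set (ℚ_[p] ⊗[ℚ] V)))}

/-- The set of all spinor genera in `gen(L)`. -/
def genS (Q : QuadraticForm ℚ V) (L : Submodule ℤ V) : Set (Set (Submodule ℤ V)) :=
  spn Q '' gen Q L

/-- The number `g(L)` of spinor genera in `gen(L)`. -/
def numSpinorGenera (Q : QuadraticForm ℚ V) (L : Submodule ℤ V) : ℕ∞ :=
  (genS Q L).encard

/-- `([N], [M])` is a representable pair by scaling `n`: there is a representation
`φ : Mⁿ → N` with `[N : φ(Mⁿ)] = n`.  Here `Mⁿ` is the lattice `M` with the scaled form `n Q`. -/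
def IsRepresentablePair (n : ℕ) (QW : QuadraticForm ℚ W) (QV : QuadraticForm ℚ V)
    (N : Submodule ℤ W) (M : Submodule ℤ V) : Prop :=
  ∃ φ : ((n : ℚ) • QV) →qᵢ QW,
    M.map (φ.toLinearMap.restrictScalars ℤ) ≤ N ∧
    (M.map (φ.toLinearMap.restrictScalars ℤ)).toAddSubgroup.relIndex N.toAddSubgroup = n

/-- A genus-correspondence between `gen(N)` and `gen(M)`: a set `C` of pairs of classes
`([N₁], [M₁])`, `N₁ ∈ gen(N)`, `M₁ ∈ gen(M)`, consisting of representable pairs by scaling `n`,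
such that every class of `gen(N)` and every class of `gen(M)` occurs in a pair of `C`. -/
structure IsGenusCorrespondence (n : ℕ) (QW : QuadraticForm ℚ W) (QV : QuadraticForm ℚ V)
    (N : Submodule ℤ W) (M : Submodule ℤ V)
    (C : Set (Set (Submodule ℤ W) × Set (Submodule ℤ V))) : Prop where
  representable : ∀ c ∈ C, ∃ N₁ ∈ gen QW N, ∃ M₁ ∈ gen QV M,
    c = (cls QW N₁, cls QV M₁) ∧ IsRepresentablePair n QW QV N₁ M₁
  left : ∀ N' ∈ gen QW N, ∃ M' ∈ gen QV M, (cls QW N', cls QV M') ∈ C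
  right : ∀ M' ∈ gen QV M, ∃ N' ∈ gen QW N, (cls QW N', cls QV M') ∈ C

/-- `C` respects spinor genus: for any two pairs `([N₁], [M₁])`, `([N₂], [M₂])` in `C`,
`N₁ ∈ spn(N₂)` if and only if `M₁ ∈ spn(M₂)`. -/
def RespectsSpinorGenus (QW : QuadraticForm ℚ W) (QV : QuadraticForm ℚ V)
    (N : Submodule ℤ W) (M : Submodule ℤ V)
    (C : Set (Set (Submodule ℤ W) × Set (Submodule ℤ V))) : Prop :=
  ∀ N₁ ∈ gen QW N, ∀ N₂ ∈ gen QW N, ∀ M₁ ∈ gen QV M, ∀ M₂ ∈ gen QV M,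
    (cls QW N₁, cls QV M₁) ∈ C → (cls QW N₂, cls QV M₂) ∈ C →
      (N₁ ∈ spn QW N₂ ↔ M₁ ∈ spn QV M₂)

end SpinorGenus

end

/-!
# Genus-correspondences that respect spinor genus

The representation `φ : Mⁿ → N` is a similitude `V ≃ W`, and similitudes carry orthogonal groups,
spinorial kernels, genera and spinor genera to each other (the factor `n` enters the spinor norm of
a rotation to an even power). So `N` may be regarded as a lattice `N₀ ⊇ M` on `V`.

Let `J = O_A(V)` be the adelic orthogonal group (`adelicOrthGroup`). It acts on the lattices of `V`
through their localizations: `Σ L` is the lattice with `(Σ L)_p = Σ_p L_p` (`glue`, `locSet_glue`).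
The genus of `L` is the orbit of `L`. By Cartan–Dieudonné every local isometry is a product of
symmetries, so commutators have trivial spinor norm, and `O(V) O'_A(V) O_A(L)` is a normal subgroup
of `J` whose cosets are the spinor genera in `gen(L)` (`glue_mem_spn_iff`,
`index_spinorClassGroup`). Let `A` and `B` be these subgroups for `N₀` and for `M`.

All pairs `(Σ N₀, Σ M)` are representable with index `n`, but the set of all of them need not
respect spinor genus, since neither of `A`, `B` need contain the other. If `A` and `B` have the same
finite index, then every coset of `A B` contains equally many cosets of `A` and of `B`, and there is
a bijection `J ⧸ A ≃ J ⧸ B` in which corresponding cosets meet (`exists_quotient_equiv`). The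
correspondence consists of the pairs `([Σ N₀], [Σ M])` for which the coset `Σ A` corresponds to
`Σ B`. It reaches every class: within a coset of `A`, the element `Σ` may be altered by `O(V)` on
the left and by the stabilizer of `N₀` on the right, neither of which changes the class `[Σ N₀]`,
and by `O'_A(V)`, which is contained in `B` (`exists_compatible_representatives`).

The indices are finite because a genus of integral ternary lattices has finitely many classes
(`finite_genS`): a basis of minimal trace has its Gram matrix bounded by the determinant
(`exists_bounded_basis`), and the determinant is the same throughout a genus (`det_gram_glue`).
The same comparison of determinants gives `[Σ N₀ : Σ M] = [N₀ : M]` (`relIndex_glue`).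
-/

/-! ### Symmetries and the spinorial kernel -/

namespace SpinorGenus

section LocalTheory

variable {K : Type*} [Field K] {U : Type*} [AddCommGroup U] [Module K U]

/-- The orthogonal group `O(U)`, as a group of linear automorphisms. -/
def orthGroup (Q : QuadraticForm K U) : Subgroup (U ≃ₗ[K] U) where
  carrier := {σ | ∀ x, Q (σ x) = Q x}
  mul_mem' {a b} ha hb x := by
    rw [LinearEquiv.mul_apply, ha, hb]
  one_mem' x := rfl
  inv_mem' {a} ha x := by
    rw [← ha (a⁻¹ x), ← LinearEquiv.mul_apply, mul_inv_cancel, LinearEquiv.coe_one, id]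

theorem symmetryAt_apply (Q : QuadraticForm K U) (v x : U) :
    symmetryAt Q v x = x - ((Q v)⁻¹ * QuadraticMap.polar Q v x) • v := by
  simp [symmetryAt, smul_smul]

theorem quadraticForm_add_smul (Q : QuadraticForm K U) (x v : U) (c : K) :
    Q (x + c • v) = Q x + c * c * Q v + c * QuadraticMap.polar Q v x := by
  rw [QuadraticMap.map_add Q, QuadraticMap.map_smul, QuadraticMap.polar_smul_right,
    QuadraticMap.polar_comm Q x v]
  simp only [smul_eq_mul]

theorem quadraticForm_sub (Q : QuadraticForm K U) (x y : U) :
    Q (x - y) = Q x + Q y - QuadraticMap.polar Q x y := by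
  have h := quadraticForm_add_smul Q x y (-1)
  rw [neg_one_smul, ← sub_eq_add_neg, QuadraticMap.polar_comm] at h
  rw [h]
  ring

theorem map_symmetryAt (Q : QuadraticForm K U) {v : U} (hv : Q v ≠ 0) (x : U) :
    Q (symmetryAt Q v x) = Q x := by
  rw [symmetryAt_apply, sub_eq_add_neg, ← neg_smul, quadraticForm_add_smul]
  field_simp
  ring

theorem symmetryAt_mul_self (Q : QuadraticForm K U) {v : U} (hv : Q v ≠ 0) :
    symmetryAt Q v * symmetryAt Q v = 1 := by
  ext x
  rw [Module.End.mul_apply, symmetryAt_apply Q v (symmetryAt Q v x), symmetryAt_apply,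
    QuadraticMap.polar_sub_right, QuadraticMap.polar_smul_right, QuadraticMap.polar_self,
    sub_sub, ← add_smul, Module.End.one_apply, sub_eq_self]
  convert zero_smul K v
  simp only [smul_eq_mul]
  field_simp
  ring

/-- If `Q x = Q y` and `x - y` is anisotropic, its symmetry carries `x` to `y`. -/
theorem symmetryAt_sub (Q : QuadraticForm K U) {x y : U} (h : Q x = Q y) (hv : Q (x - y) ≠ 0) :
    symmetryAt Q (x - y) x = y := by
  have h1 : QuadraticMap.polar Q (x - y) x = Q (x - y) := by
    rw [QuadraticMap.polar_sub_left, QuadraticMap.polar_self, quadraticForm_sub, h,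
      QuadraticMap.polar_comm Q y x, two_nsmul]
  rw [symmetryAt_apply, h1, inv_mul_cancel₀ hv, one_smul]
  abel

theorem symmetryAt_self (Q : QuadraticForm K U) {x : U} (hv : Q x ≠ 0) :
    symmetryAt Q x x = -x := by
  have h : (Q x)⁻¹ * (Q x + Q x) = 2 := by field_simp; norm_num
  rw [symmetryAt_apply, QuadraticMap.polar_self, two_nsmul, h, two_smul]
  abel

theorem symmetryAt_of_polar_eq_zero (Q : QuadraticForm K U) {v x : U}
    (h : QuadraticMap.polar Q v x = 0) : symmetryAt Q v x = x := by
  rw [symmetryAt_apply, h, mul_zero, zero_smul, sub_zero]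

/-- The composite of the symmetries in a list of vectors. -/
abbrev symmetryProd (Q : QuadraticForm K U) (l : List U) : Module.End K U :=
  (l.map (symmetryAt Q)).prod

theorem map_symmetryProd (Q : QuadraticForm K U) {l : List U} (hl : ∀ v ∈ l, Q v ≠ 0) (x : U) :
    Q (symmetryProd Q l x) = Q x := by
  induction l with
  | nil => rfl
  | cons v l ih =>
    simp only [List.mem_cons, forall_eq_or_imp] at hl
    rw [symmetryProd, List.map_cons, List.prod_cons, Module.End.mul_apply, map_symmetryAt Q hl.1,
      ih hl.2]

theorem symmetryProd_append (Q : QuadraticForm K U) (l m : List U) :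
    symmetryProd Q (l ++ m) = symmetryProd Q l * symmetryProd Q m := by
  simp [symmetryProd]

theorem symmetryProd_mul_reverse (Q : QuadraticForm K U) {l : List U} (hl : ∀ v ∈ l, Q v ≠ 0) :
    symmetryProd Q l * symmetryProd Q l.reverse = 1 := by
  induction l with
  | nil => simp [symmetryProd]
  | cons v l ih =>
    simp only [List.mem_cons, forall_eq_or_imp] at hl
    rw [List.reverse_cons, symmetryProd_append, symmetryProd, List.map_cons, List.prod_cons,
      mul_assoc, ← mul_assoc _ (symmetryProd Q l.reverse), ih hl.2, one_mul, symmetryProd,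
      List.map_singleton, List.prod_singleton, symmetryAt_mul_self Q hl.1]

theorem symmetryProd_reverse_mul (Q : QuadraticForm K U) {l : List U} (hl : ∀ v ∈ l, Q v ≠ 0) :
    symmetryProd Q l.reverse * symmetryProd Q l = 1 := by
  simpa using symmetryProd_mul_reverse Q (l := l.reverse) (by simpa using hl)

/-- A vector is carried to any other of the same nonzero length by at most two symmetries, in
vectors orthogonal to everything that is orthogonal to both: one of
`x - y`, `x + y` is anisotropic. -/
theorem exists_symmetryProd_apply_eq [NeZero (2 : K)] (Q : QuadraticForm K U) {x y : U}
    (h : Q x = Q y) (hy : Q y ≠ 0) :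
    ∃ l : List U, (∀ v ∈ l, Q v ≠ 0) ∧ symmetryProd Q l x = y ∧
      ∀ z, QuadraticMap.polar Q x z = 0 → QuadraticMap.polar Q y z = 0 →
        symmetryProd Q l z = z := by
  by_cases hv : Q (x - y) = 0
  · have hv' : Q (x - -y) ≠ 0 := by
      intro h0
      rw [sub_neg_eq_add] at h0
      have h1 := quadraticForm_sub Q x y
      have h2 := QuadraticMap.map_add Q x y
      have h3 : (2 : K) * 2 * Q y = 0 := by linear_combination h0 + hv - h1 - h2 - 2 * h
      exact hy (by simpa [NeZero.ne (2 : K)] using h3)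
    refine ⟨[y, x - -y], ?_, ?_, fun z hx hz => ?_⟩
    · simp only [List.mem_cons, List.not_mem_nil, or_false, forall_eq_or_imp, forall_eq]
      exact ⟨hy, hv'⟩
    · simp only [symmetryProd, List.map_cons, List.map_nil, List.prod_cons, List.prod_nil, mul_one,
        Module.End.mul_apply]
      rw [symmetryAt_sub Q (by rw [QuadraticMap.map_neg, h]) hv', map_neg, symmetryAt_self Q hy,
        neg_neg]
    · simp only [symmetryProd, List.map_cons, List.map_nil, List.prod_cons, List.prod_nil, mul_one,
        Module.End.mul_apply]
      rw [symmetryAt_of_polar_eq_zero Q (v := x - -y), symmetryAt_of_polar_eq_zero Q hz]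
      rw [sub_neg_eq_add, QuadraticMap.polar_add_left, hx, hz, add_zero]
  · refine ⟨[x - y], by simpa using hv, ?_, fun z hx hz => ?_⟩
    · simpa [symmetryProd] using symmetryAt_sub Q h hv
    · simp only [symmetryProd, List.map_cons, List.map_nil, List.prod_cons, List.prod_nil, mul_one]
      apply symmetryAt_of_polar_eq_zero
      rw [QuadraticMap.polar_sub_left, hx, hz, sub_zero]

/-- Cartan–Dieudonné, without a bound on the number of factors: on a space with an anisotropic
orthogonal basis every isometry is a product of symmetries.  The basis vectors are moved back into
place one at a time. -/
theorem exists_symmetryProd_eq [NeZero (2 : K)] (Q : QuadraticForm K U) {k : ℕ}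
    (b : Module.Basis (Fin k) K U) (hb : ∀ i j, i ≠ j → QuadraticMap.polar Q (b i) (b j) = 0)
    (hb0 : ∀ i, Q (b i) ≠ 0) {σ : U ≃ₗ[K] U} (hσ : σ ∈ orthGroup Q) :
    ∃ l : List U, (∀ v ∈ l, Q v ≠ 0) ∧ symmetryProd Q l = σ.toLinearMap := by
  have key : ∀ m ≤ k, ∃ l : List U, (∀ v ∈ l, Q v ≠ 0) ∧
      ∀ i : Fin k, (i : ℕ) < m → symmetryProd Q l (σ (b i)) = b i := by
    intro m
    induction m with
    | zero => exact fun _ => ⟨[], by simp⟩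
    | succ m ih =>
      intro hm
      obtain ⟨l, hl, hfix⟩ := ih (by omega)
      set i₀ : Fin k := ⟨m, hm⟩
      have hiso : ∀ x, Q (symmetryProd Q l (σ x)) = Q x := fun x => by
        rw [map_symmetryProd Q hl, hσ x]
      have hpol : ∀ x y, QuadraticMap.polar Q (symmetryProd Q l (σ x)) (symmetryProd Q l (σ y)) =
          QuadraticMap.polar Q x y := fun x y => by
        simp only [QuadraticMap.polar, ← map_add, hiso]
      obtain ⟨l', hl', h1, h2⟩ := exists_symmetryProd_apply_eq Q (hiso (b i₀)) (hb0 i₀)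
      refine ⟨l' ++ l, ?_, fun i hi => ?_⟩
      · intro v hv
        rcases List.mem_append.mp hv with h | h
        exacts [hl' v h, hl v h]
      · rw [symmetryProd_append, Module.End.mul_apply]
        rcases Nat.lt_succ_iff_lt_or_eq.mp hi with h | h
        · rw [hfix i h]
          have hne : i₀ ≠ i := by
            intro h'; rw [← h'] at h; exact lt_irrefl _ h
          refine h2 _ ?_ (hb _ _ hne)
          conv_lhs => rw [← hfix i h]
          rw [hpol, hb _ _ hne]
        · have : i = i₀ := Fin.ext h
          rw [this, h1]
  obtain ⟨l, hl, hfix⟩ := key k le_rfl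
  refine ⟨l.reverse, by simpa using hl, ?_⟩
  have h1 : symmetryProd Q l * σ.toLinearMap = 1 := b.ext fun i => hfix i i.2
  have := symmetryProd_reverse_mul Q hl
  calc symmetryProd Q l.reverse
      = symmetryProd Q l.reverse * (symmetryProd Q l * σ.toLinearMap) := by rw [h1, mul_one]
    _ = _ := by rw [← mul_assoc, this, one_mul]

/-- The spinorial kernel `O'(U)`, as a group of linear automorphisms. -/
def spinorGroup (Q : QuadraticForm K U) : Subgroup (U ≃ₗ[K] U) where
  carrier := {σ | ∃ l : List U, Even l.length ∧ (∀ v ∈ l, Q v ≠ 0) ∧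
    symmetryProd Q l = σ.toLinearMap ∧ IsSquare (l.map Q).prod}
  mul_mem' {a b} := by
    rintro ⟨l, h1, h2, h3, h4⟩ ⟨m, k1, k2, k3, k4⟩
    refine ⟨l ++ m, by simpa using h1.add k1, fun v hv => ?_, ?_, by simpa using h4.mul k4⟩
    · rcases List.mem_append.mp hv with h | h
      exacts [h2 v h, k2 v h]
    · rw [symmetryProd_append, h3, k3]
      rfl
  one_mem' := ⟨[], by simp, by simp, rfl, by simp⟩
  inv_mem' {a} := by
    rintro ⟨l, h1, h2, h3, h4⟩
    refine ⟨l.reverse, by simpa using h1, by simpa using h2, ?_, ?_⟩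
    · have h := symmetryProd_reverse_mul Q h2
      rw [h3] at h
      ext x
      have := congrArg (fun f : Module.End K U => f (a⁻¹ x)) h
      simp only [Module.End.mul_apply, Module.End.one_apply, LinearEquiv.coe_coe] at this
      rwa [← LinearEquiv.mul_apply, mul_inv_cancel, LinearEquiv.coe_one, id] at this
    · rwa [List.map_reverse, List.prod_reverse]

theorem spinorGroup_le_orthGroup (Q : QuadraticForm K U) : spinorGroup Q ≤ orthGroup Q := by
  rintro σ ⟨l, -, h2, h3, -⟩ x
  have := map_symmetryProd Q h2 x
  rwa [h3] at this

theorem mem_spinorKernel_iff {Q : QuadraticForm K U} {σ : Q.IsometryEquiv Q} :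
    σ ∈ spinorKernel Q ↔ σ.toLinearEquiv ∈ spinorGroup Q := by
  constructor
  · rintro ⟨c, hc, l, h1, h2, h3, rfl⟩
    exact ⟨l, h1, h2, h3, hc⟩
  · rintro ⟨l, h1, h2, h3, hc⟩
    exact ⟨_, hc, l, h1, h2, h3, rfl⟩

/-- A commutator `τ_l τ_m τ_l⁻¹ τ_m⁻¹` involves every symmetry twice, so its spinor norm is
trivial. -/
theorem commutator_mem_spinorGroup {Q : QuadraticForm K U} {σ τ : U ≃ₗ[K] U} {l m : List U}
    (hl : ∀ v ∈ l, Q v ≠ 0) (hm : ∀ v ∈ m, Q v ≠ 0)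
    (hσ : symmetryProd Q l = σ.toLinearMap) (hτ : symmetryProd Q m = τ.toLinearMap) :
    σ * τ * σ⁻¹ * τ⁻¹ ∈ spinorGroup Q := by
  have inv : ∀ {l : List U} {σ : U ≃ₗ[K] U}, (∀ v ∈ l, Q v ≠ 0) →
      symmetryProd Q l = σ.toLinearMap → symmetryProd Q l.reverse = (σ⁻¹).toLinearMap := by
    intro l σ hl hσ
    have h := symmetryProd_reverse_mul Q hl
    rw [hσ] at h
    ext x
    have := congrArg (fun f : Module.End K U => f (σ⁻¹ x)) h
    simp only [Module.End.mul_apply, Module.End.one_apply, LinearEquiv.coe_coe] at this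
    rwa [← LinearEquiv.mul_apply, mul_inv_cancel, LinearEquiv.coe_one, id] at this
  refine ⟨l ++ m ++ l.reverse ++ m.reverse, ?_, ?_, ?_, ?_⟩
  · refine ⟨l.length + m.length, ?_⟩
    simp only [List.length_append, List.length_reverse]
    ring
  · intro v hv
    simp only [List.mem_append, List.mem_reverse] at hv
    rcases hv with ((h | h) | h) | h
    exacts [hl v h, hm v h, hl v h, hm v h]
  · rw [symmetryProd_append, symmetryProd_append, symmetryProd_append, hσ, hτ, inv hl hσ, inv hm hτ]
    rfl
  · refine ⟨(l.map Q).prod * (m.map Q).prod, ?_⟩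
    simp only [List.map_append, List.map_reverse, List.prod_append, List.prod_reverse]
    ring

end LocalTheory

end SpinorGenus

/-! ### Matching cosets of two subgroups of the same index -/

namespace SpinorGenus

section Matching

variable {J : Type*} [Group J]

/-- For normal subgroups `A`, `B` of the same finite index there is a bijection of cosets
`J ⧸ A ≃ J ⧸ B` under which corresponding cosets always meet: cosets of `A` and of `B` meet
precisely when they lie in the same coset of `A ⊔ B`, and each coset of `A ⊔ B` contains equally
many of both kinds. -/
theorem exists_quotient_equiv (A B : Subgroup J) [A.Normal] [B.Normal]
    (hA : A.index ≠ 0) (h : A.index = B.index) :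
    ∃ f : J ⧸ A ≃ J ⧸ B, ∀ g : J, ∃ a ∈ A, f (g : J ⧸ A) = ((g * a : J) : J ⧸ B) := by
  have hrel : A.relIndex (A ⊔ B) = B.relIndex (A ⊔ B) := by
    have h1 := Subgroup.relIndex_mul_index (le_sup_left : A ≤ A ⊔ B)
    have h2 := Subgroup.relIndex_mul_index (le_sup_right : B ≤ A ⊔ B)
    have h3 : (A ⊔ B).index ≠ 0 := fun h0 => hA (by rw [← h1, h0, mul_zero])
    exact Nat.eq_of_mul_eq_mul_right (Nat.pos_of_ne_zero h3) (by rw [h1, h2, h])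
  have hA0 : A.relIndex (A ⊔ B) ≠ 0 := fun h0 => hA (by
    rw [← Subgroup.relIndex_mul_index (le_sup_left : A ≤ A ⊔ B), h0, zero_mul])
  have fA : Finite (↥(A ⊔ B) ⧸ A.subgroupOf (A ⊔ B)) :=
    Nat.finite_of_card_ne_zero hA0
  have fB : Finite (↥(A ⊔ B) ⧸ B.subgroupOf (A ⊔ B)) :=
    Nat.finite_of_card_ne_zero (show B.relIndex (A ⊔ B) ≠ 0 from hrel ▸ hA0)
  obtain ⟨e⟩ : Nonempty ((↥(A ⊔ B) ⧸ A.subgroupOf (A ⊔ B)) ≃ (↥(A ⊔ B) ⧸ B.subgroupOf (A ⊔ B))) :=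
    Finite.card_eq.mp hrel
  let eA := Subgroup.quotientEquivProdOfLE (le_sup_left : A ≤ A ⊔ B)
  let eB := Subgroup.quotientEquivProdOfLE (le_sup_right : B ≤ A ⊔ B)
  let f : J ⧸ A ≃ J ⧸ B := (eA.trans ((Equiv.refl _).prodCongr e)).trans eB.symm
  have hf : ∀ x, (eB (f x)).1 = (eA x).1 := fun x => by simp [f]
  refine ⟨f, fun g => ?_⟩
  obtain ⟨y, hy⟩ := QuotientGroup.mk_surjective (f g)
  have h1 := hf g
  rw [← hy] at h1
  have h2 : ((y : J) : J ⧸ (A ⊔ B)) = g := h1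
  have h3 : g⁻¹ * y ∈ ((A ⊔ B : Subgroup J) : Set J) := QuotientGroup.eq.mp h2.symm
  rw [Subgroup.mul_normal] at h3
  obtain ⟨a, ha, b, hb, hab⟩ := Set.mem_mul.mp h3
  refine ⟨a, ha, ?_⟩
  rw [← hy, eq_comm, QuotientGroup.eq]
  have : (g * a)⁻¹ * y = b := by
    rw [mul_inv_rev, mul_assoc, ← hab]; group
  rwa [this]

theorem normal_of_commutator_mem {K A : Subgroup J} (hK : ∀ a b : J, a * b * a⁻¹ * b⁻¹ ∈ K)
    (h : K ≤ A) : A.Normal where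
  conj_mem x hx g := by
    have := A.mul_mem (h (hK g x)) hx
    rwa [inv_mul_cancel_right] at this

/-- Let `K` contain all commutators and let `O K S`, `O K T` have the same finite index.  There is
a set `X` that meets all double cosets in `O \ J / S` and in `O \ J / T`, and on which lying in
the same coset of `O K S` means lying in the same coset of `O K T`. -/
theorem exists_compatible_representatives (O K S T : Subgroup J)
    (hK : ∀ a b : J, a * b * a⁻¹ * b⁻¹ ∈ K)
    (hfin : (O ⊔ K ⊔ S).index ≠ 0) (hidx : (O ⊔ K ⊔ S).index = (O ⊔ K ⊔ T).index) :
    ∃ X : Set J, (∀ g, ∃ o ∈ O, ∃ s ∈ S, o * g * s ∈ X) ∧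
      (∀ g, ∃ o ∈ O, ∃ t ∈ T, o * g * t ∈ X) ∧
      ∀ g ∈ X, ∀ h ∈ X, g⁻¹ * h ∈ O ⊔ K ⊔ S ↔ g⁻¹ * h ∈ O ⊔ K ⊔ T := by
  have hKn : K.Normal := normal_of_commutator_mem hK le_rfl
  have hKA : K ≤ O ⊔ K ⊔ S := le_sup_right.trans le_sup_left
  have hKB : K ≤ O ⊔ K ⊔ T := le_sup_right.trans le_sup_left
  have hAn : (O ⊔ K ⊔ S).Normal := normal_of_commutator_mem hK hKA
  have hBn : (O ⊔ K ⊔ T).Normal := normal_of_commutator_mem hK hKB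
  have hOKn : (O ⊔ K).Normal := normal_of_commutator_mem hK le_sup_right
  -- `g * o * k * s` may be replaced by `o * g * s`, modulo `K`
  have swap : ∀ (S : Subgroup J) (g : J), ∀ a ∈ O ⊔ K ⊔ S,
      ∃ o ∈ O, ∃ s ∈ S, (g * a)⁻¹ * (o * g * s) ∈ K := by
    intro S g a ha
    have ha' : a ∈ ((O ⊔ K ⊔ S : Subgroup J) : Set J) := ha
    rw [Subgroup.normal_mul] at ha'
    obtain ⟨x, hx, s, hs, rfl⟩ := Set.mem_mul.mp ha'
    rw [Subgroup.mul_normal] at hx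
    obtain ⟨o, ho, k, hk, rfl⟩ := Set.mem_mul.mp hx
    refine ⟨o, ho, s, hs, ?_⟩
    have := hKn.conj_mem _ (K.mul_mem (K.inv_mem hk) (hK o⁻¹ g⁻¹)) s⁻¹
    convert this using 1
    group
  obtain ⟨f, hf⟩ := exists_quotient_equiv (O ⊔ K ⊔ S) (O ⊔ K ⊔ T) hfin hidx
  refine ⟨{g | f g = (g : J ⧸ (O ⊔ K ⊔ T))}, fun g => ?_, fun g => ?_, fun g hg h hh => ?_⟩
  · obtain ⟨a, ha, h⟩ := hf g
    obtain ⟨o, ho, s, hs, hk⟩ := swap S g a ha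
    refine ⟨o, ho, s, hs, ?_⟩
    have h1 : ((g * a : J) : J ⧸ (O ⊔ K ⊔ S)) = ((o * g * s : J) : J ⧸ (O ⊔ K ⊔ S)) :=
      QuotientGroup.eq.mpr (hKA hk)
    have h2 : ((g * a : J) : J ⧸ (O ⊔ K ⊔ T)) = ((o * g * s : J) : J ⧸ (O ⊔ K ⊔ T)) :=
      QuotientGroup.eq.mpr (hKB hk)
    have h3 : ((g : J) : J ⧸ (O ⊔ K ⊔ S)) = ((g * a : J) : J ⧸ (O ⊔ K ⊔ S)) :=
      QuotientGroup.eq.mpr (by simpa using ha)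
    rw [Set.mem_ofPred_eq, ← h1, ← h3, h, h2]
  · obtain ⟨y, hy⟩ := QuotientGroup.mk_surjective (f.symm g)
    obtain ⟨a, ha, h⟩ := hf y
    rw [hy, Equiv.apply_symm_apply] at h
    obtain ⟨o, ho, t, ht, hk⟩ := swap T g (g⁻¹ * (y * a)) (QuotientGroup.eq.mp h)
    rw [mul_inv_cancel_left] at hk
    refine ⟨o, ho, t, ht, ?_⟩
    have h1 : ((y * a : J) : J ⧸ (O ⊔ K ⊔ S)) = ((o * g * t : J) : J ⧸ (O ⊔ K ⊔ S)) :=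
      QuotientGroup.eq.mpr (hKA hk)
    have h2 : ((y * a : J) : J ⧸ (O ⊔ K ⊔ T)) = ((o * g * t : J) : J ⧸ (O ⊔ K ⊔ T)) :=
      QuotientGroup.eq.mpr (hKB hk)
    have h3 : ((y : J) : J ⧸ (O ⊔ K ⊔ S)) = ((y * a : J) : J ⧸ (O ⊔ K ⊔ S)) :=
      QuotientGroup.eq.mpr (by simpa using ha)
    rw [Set.mem_ofPred_eq, ← h1, ← h3, hy, Equiv.apply_symm_apply, h, h2]
  · rw [← QuotientGroup.eq, ← QuotientGroup.eq, ← f.apply_eq_iff_eq, hg, hh]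

end Matching

end SpinorGenus

/-! ### Lattices and their localizations -/

namespace SpinorGenus

open Filter

/-- Primality as an instance, so that `ℚ_[p]` makes sense for `p : Nat.Primes`. -/
instance factPrime (p : Nat.Primes) : Fact (p : ℕ).Prime := ⟨p.2⟩

section Padic

/-- A rational number that is a `p`-adic integer for every `p` is an integer. -/
theorem exists_int_eq_of_norm_le_one {r : ℚ} (h : ∀ p : Nat.Primes, ‖(r : ℚ_[p])‖ ≤ 1) :
    ∃ z : ℤ, r = z := by
  refine ⟨r.num, (Rat.den_eq_one_iff r).mp ?_ |>.symm⟩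
  by_contra hden
  obtain ⟨p, hp, hdvd⟩ := Nat.exists_prime_and_dvd hden
  have : Fact p.Prime := ⟨hp⟩
  have h1 := PadicInt.isUnit_iff.mp (PadicInt.isUnit_den r (h ⟨p, hp⟩))
  have h2 : ‖((r.den : ℤ) : ℤ_[p])‖ < 1 :=
    (PadicInt.norm_int_lt_one_iff_dvd _).mpr (by exact_mod_cast hdvd)
  rw [Int.cast_natCast, h1] at h2
  exact lt_irrefl _ h2

theorem norm_natCast_le_one (p : ℕ) [Fact p.Prime] (z : ℕ) : ‖(z : ℚ_[p])‖ ≤ 1 := by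
  simpa using Padic.norm_int_le_one (p := p) (z : ℤ)

theorem norm_natCast_eq_one {p : ℕ} [Fact p.Prime] {m : ℕ} (h : ¬ p ∣ m) :
    ‖(m : ℚ_[p])‖ = 1 := by
  refine le_antisymm (norm_natCast_le_one p m) (not_lt.mp fun hlt => h ?_)
  exact Padic.norm_natCast_lt_one_iff.mp hlt

theorem exists_norm_pow_mul_le_one (p : ℕ) [Fact p.Prime] (y : ℚ_[p]) :
    ∃ k : ℕ, ‖(p : ℚ_[p]) ^ k * y‖ ≤ 1 := by
  obtain ⟨k, hk⟩ := PadicInt.exists_pow_neg_lt p (ε := 1 / (‖y‖ + 1)) (by positivity)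
  refine ⟨k, ?_⟩
  rw [norm_mul, norm_pow, Padic.norm_p]
  have h1 : ((p : ℝ)⁻¹) ^ k < 1 / (‖y‖ + 1) := by
    simpa [zpow_neg, inv_pow] using hk
  rw [lt_div_iff₀ (by positivity)] at h1
  nlinarith [norm_nonneg y, show (0 : ℝ) ≤ ((p : ℝ)⁻¹) ^ k by positivity]

/-- `ℚ_p = ℤ[1/p] + ℤ_p`. -/
theorem exists_rat_approx (p : Nat.Primes) (y : ℚ_[p]) :
    ∃ r : ℚ, ‖(r : ℚ_[p]) - y‖ ≤ 1 ∧ ∀ q : Nat.Primes, q ≠ p → ‖(r : ℚ_[q])‖ ≤ 1 := by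
  obtain ⟨k, hk⟩ := exists_norm_pow_mul_le_one p y
  set x : ℤ_[p] := ⟨(p : ℚ_[p]) ^ k * y, hk⟩ with hx
  have hp0 : (p : ℚ_[p]) ≠ 0 := by exact_mod_cast p.2.ne_zero
  refine ⟨(x.appr k : ℚ) / (p : ℚ) ^ k, ?_, fun q hq => ?_⟩
  · have h1 : ‖x - (x.appr k : ℤ_[p])‖ ≤ (p : ℝ) ^ (-k : ℤ) :=
      (PadicInt.norm_le_pow_iff_mem_span_pow _ _).mpr (PadicInt.appr_spec k x)
    have h2 : (((x.appr k : ℚ) / (p : ℚ) ^ k : ℚ) : ℚ_[p]) - y =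
        -((p : ℚ_[p]) ^ k)⁻¹ * ((x - (x.appr k : ℤ_[p]) : ℤ_[p]) : ℚ_[p]) := by
      push_cast
      rw [hx]
      field_simp
      ring
    have h4 : ‖((x - (x.appr k : ℤ_[p]) : ℤ_[p]) : ℚ_[p])‖ ≤ (p : ℝ) ^ (-k : ℤ) := h1
    rw [h2, norm_mul, norm_neg, norm_inv, norm_pow, Padic.norm_p]
    have hpR : (0 : ℝ) < p := by exact_mod_cast p.2.pos
    calc _ ≤ (((p : ℝ)⁻¹) ^ k)⁻¹ * (p : ℝ) ^ (-k : ℤ) := by gcongr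
      _ = 1 := by rw [zpow_neg, zpow_natCast, inv_pow, inv_inv]; field_simp
  · have h1 : ‖(p : ℚ_[q])‖ = 1 := norm_natCast_eq_one fun h =>
      hq (Subtype.ext ((Nat.prime_dvd_prime_iff_eq q.2 p.2).mp h))
    push_cast
    rw [norm_div, norm_pow, h1, one_pow, div_one]
    exact norm_natCast_le_one _ _

end Padic

variable {V : Type*} [AddCommGroup V] [Module ℚ V]

section Bases

variable {ι : Type*}

theorem exists_basis_span_eq {k : ℕ} (hV : Module.finrank ℚ V = k) (L : Submodule ℤ V)
    (hL : Submodule.IsLattice ℚ L) :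
    ∃ b : Module.Basis (Fin k) ℚ V, L = Submodule.span ℤ (Set.range b) := by
  have e : Module.Free.ChooseBasisIndex ℤ L ≃ Fin k := by
    apply Fintype.equivFinOfCardEq
    rw [← hV, Module.finrank_eq_card_basis
      ((Module.Free.chooseBasis ℤ L).extendOfIsLattice ℚ)]
  let b₀ : Module.Basis (Fin k) ℤ L := (Module.Free.chooseBasis ℤ L).reindex e
  refine ⟨b₀.extendOfIsLattice ℚ, ?_⟩
  have h1 : Set.range (b₀.extendOfIsLattice ℚ) = L.subtype '' Set.range b₀ := by
    rw [← Set.range_comp]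
    congr 1
    ext i
    simp
  rw [h1, Submodule.span_image, b₀.span_eq, Submodule.map_top, Submodule.range_subtype]

theorem isLattice_span [Finite ι] (b : Module.Basis ι ℚ V) :
    Submodule.IsLattice ℚ (Submodule.span ℤ (Set.range b)) where
  fg := Submodule.fg_span (Set.finite_range b)
  span_eq_top := by rw [Submodule.span_span_of_tower, b.span_eq]

theorem mem_span_int_iff (b : Module.Basis ι ℚ V) (x : V) :
    x ∈ Submodule.span ℤ (Set.range b) ↔ ∀ i, ∃ z : ℤ, b.repr x i = z := by
  rw [b.mem_span_iff_repr_mem ℤ]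
  simp [eq_comm]

theorem localLattice_span (p : ℕ) [Fact p.Prime] (b : Module.Basis ι ℚ V) :
    localLattice p (Submodule.span ℤ (Set.range b)) =
      Submodule.span ℤ_[p] (Set.range (b.baseChange ℚ_[p])) := by
  apply le_antisymm
  · refine Submodule.span_le.mpr ?_
    rintro _ ⟨x, hx, rfl⟩
    rw [SetLike.mem_coe, (b.baseChange ℚ_[p]).mem_span_iff_repr_mem ℤ_[p]]
    intro i
    obtain ⟨z, hz⟩ := (mem_span_int_iff b x).mp hx i
    exact ⟨z, by simp [hz]⟩
  · refine Submodule.span_mono ?_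
    rintro _ ⟨i, rfl⟩
    exact ⟨b i, Submodule.subset_span ⟨i, rfl⟩, by simp⟩

theorem mem_localLattice_span_iff (p : ℕ) [Fact p.Prime] (b : Module.Basis ι ℚ V)
    (x : ℚ_[p] ⊗[ℚ] V) :
    x ∈ localLattice p (Submodule.span ℤ (Set.range b)) ↔
      ∀ i, ‖(b.baseChange ℚ_[p]).repr x i‖ ≤ 1 := by
  rw [localLattice_span, (b.baseChange ℚ_[p]).mem_span_iff_repr_mem ℤ_[p]]
  refine forall_congr' fun i => ⟨?_, fun h => ⟨⟨_, h⟩, rfl⟩⟩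
  rintro ⟨z, hz⟩
  rw [← hz]
  exact z.2

end Bases

section Localization

theorem tmul_mem_localLattice (p : ℕ) [Fact p.Prime] {L : Submodule ℤ V} {x : V} (hx : x ∈ L) :
    (1 : ℚ_[p]) ⊗ₜ[ℚ] x ∈ localLattice p L :=
  Submodule.subset_span ⟨x, hx, rfl⟩

/-- A lattice is the intersection of its localizations. -/
theorem mem_iff_forall_localLattice [FiniteDimensional ℚ V] {L : Submodule ℤ V}
    (hL : Submodule.IsLattice ℚ L) (x : V) :
    x ∈ L ↔ ∀ p : Nat.Primes, (1 : ℚ_[p]) ⊗ₜ[ℚ] x ∈ localLattice p L := by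
  refine ⟨fun h p => tmul_mem_localLattice p h, fun h => ?_⟩
  obtain ⟨b, rfl⟩ := exists_basis_span_eq rfl L hL
  rw [mem_span_int_iff]
  refine fun i => exists_int_eq_of_norm_le_one fun p => ?_
  have := (mem_localLattice_span_iff p b _).mp (h p) i
  simpa using this

theorem eq_of_localLattice_eq [FiniteDimensional ℚ V] {L K : Submodule ℤ V}
    (hL : Submodule.IsLattice ℚ L) (hK : Submodule.IsLattice ℚ K)
    (h : ∀ p : Nat.Primes, localLattice p L = localLattice p K) : L = K := by
  ext x
  simp only [mem_iff_forall_localLattice hL, mem_iff_forall_localLattice hK, h]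

/-- Every finitely generated subgroup is carried into a given lattice by a multiplication. -/
theorem exists_nsmul_mem {L : Submodule ℤ V} (hL : Submodule.IsLattice ℚ L) {K : Submodule ℤ V}
    (hK : K.FG) : ∃ m : ℕ, m ≠ 0 ∧ ∀ x ∈ K, m • x ∈ L := by
  induction K, hK using Submodule.fg_induction with
  | singleton x =>
    have hx : x ∈ Submodule.span ℚ (L : Set V) := hL.span_eq_top ▸ Submodule.mem_top
    have : ∃ m : ℕ, m ≠ 0 ∧ m • x ∈ L := by
      induction hx using Submodule.span_induction with
      | mem x h => exact ⟨1, one_ne_zero, by simpa using h⟩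
      | zero => exact ⟨1, one_ne_zero, by simp⟩
      | add x y _ _ hx hy =>
        obtain ⟨m, hm, hx⟩ := hx
        obtain ⟨k, hk, hy⟩ := hy
        refine ⟨m * k, mul_ne_zero hm hk, ?_⟩
        rw [smul_add, mul_smul m k y, mul_comm m k, mul_smul k m x]
        exact add_mem (L.smul_of_tower_mem k hx) (L.smul_of_tower_mem m hy)
      | smul r x _ hx =>
        obtain ⟨m, hm, hx⟩ := hx
        refine ⟨r.den * m, mul_ne_zero r.den_nz hm, ?_⟩
        have : (r.den * m) • r • x = r.num • m • x := by
          rw [← Nat.cast_smul_eq_nsmul ℚ, ← Nat.cast_smul_eq_nsmul ℚ, ← Int.cast_smul_eq_zsmul ℚ,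
            smul_smul, smul_smul, ← Rat.mul_den_eq_num]
          congr 1
          push_cast
          ring
        rw [this]
        exact L.smul_mem _ hx
    obtain ⟨m, hm, h⟩ := this
    refine ⟨m, hm, fun y hy => ?_⟩
    obtain ⟨z, rfl⟩ := Submodule.mem_span_singleton.mp hy
    rw [smul_comm]
    exact L.smul_mem _ h
  | sup K₁ K₂ _ _ h₁ h₂ =>
    obtain ⟨m, hm, h₁⟩ := h₁
    obtain ⟨k, hk, h₂⟩ := h₂
    refine ⟨m * k, mul_ne_zero hm hk, fun x hx => ?_⟩
    obtain ⟨y, hy, z, hz, rfl⟩ := Submodule.mem_sup.mp hx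
    rw [smul_add, mul_smul m k z, mul_comm m k, mul_smul k m y]
    exact add_mem (L.smul_of_tower_mem k (h₁ y hy)) (L.smul_of_tower_mem m (h₂ z hz))

theorem nsmul_mem_localLattice (p : ℕ) [Fact p.Prime] {L K : Submodule ℤ V} {m : ℕ}
    (h : ∀ x ∈ K, m • x ∈ L) {x : ℚ_[p] ⊗[ℚ] V} (hx : x ∈ localLattice p K) :
    m • x ∈ localLattice p L := by
  induction hx using Submodule.span_induction with
  | mem y hy =>
    obtain ⟨x, hx, rfl⟩ := hy
    have := tmul_mem_localLattice p (h x hx)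
    rwa [TensorProduct.tmul_smul] at this
  | zero => simp
  | add x y _ _ hx hy => rw [smul_add]; exact add_mem hx hy
  | smul r x _ hx => rw [smul_comm]; exact Submodule.smul_mem _ _ hx

theorem mem_of_nsmul_mem {p : ℕ} [Fact p.Prime] {m : ℕ} (hm : ¬ p ∣ m)
    {S : Submodule ℤ_[p] (ℚ_[p] ⊗[ℚ] V)} {x : ℚ_[p] ⊗[ℚ] V} (h : m • x ∈ S) : x ∈ S := by
  have hu : IsUnit (m : ℤ_[p]) := by
    rw [PadicInt.isUnit_iff]
    have := norm_natCast_eq_one hm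
    simpa [PadicInt.norm_def] using this
  rw [← Nat.cast_smul_eq_nsmul ℤ_[p]] at h
  exact (Submodule.smul_mem_iff_of_isUnit S hu).mp h

theorem finite_primes_dvd {m : ℕ} (hm : m ≠ 0) : ∀ᶠ p : Nat.Primes in cofinite, ¬ (p : ℕ) ∣ m := by
  have : {p : Nat.Primes | (p : ℕ) ∣ m}.Finite := by
    refine Set.Finite.of_finite_image (f := fun p : Nat.Primes => (p : ℕ)) ?_
      (Subtype.val_injective.injOn)
    refine (Set.finite_Iic m).subset ?_
    rintro _ ⟨p, hp, rfl⟩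
    exact Nat.le_of_dvd (Nat.pos_of_ne_zero hm) hp
  simpa [Filter.eventually_cofinite] using this

/-- Two lattices on the same space agree at almost all primes. -/
theorem eventually_localLattice_eq {L K : Submodule ℤ V} (hL : Submodule.IsLattice ℚ L)
    (hK : Submodule.IsLattice ℚ K) :
    ∀ᶠ p : Nat.Primes in cofinite, localLattice p L = localLattice p K := by
  obtain ⟨m, hm, h1⟩ := exists_nsmul_mem hL hK.fg
  obtain ⟨k, hk, h2⟩ := exists_nsmul_mem hK hL.fg
  filter_upwards [finite_primes_dvd hm, finite_primes_dvd hk] with p hpm hpk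
  apply le_antisymm
  · exact fun x hx => mem_of_nsmul_mem hpk (nsmul_mem_localLattice p h2 hx)
  · exact fun x hx => mem_of_nsmul_mem hpm (nsmul_mem_localLattice p h1 hx)

end Localization

end SpinorGenus

/-! ### Gluing local lattices -/

namespace SpinorGenus

open Filter
open scoped Pointwise

variable {V : Type*} [AddCommGroup V] [Module ℚ V]

/-- The linear automorphisms of `V_p`. -/
abbrev LocalAut (V : Type*) [AddCommGroup V] [Module ℚ V] (p : Nat.Primes) : Type _ :=
  (ℚ_[p] ⊗[ℚ] V) ≃ₗ[ℚ_[p]] (ℚ_[p] ⊗[ℚ] V)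

/-- `L_p` as a set, on which `LocalAut V p` acts. -/
abbrev locSet (p : Nat.Primes) (L : Submodule ℤ V) : Set (ℚ_[p] ⊗[ℚ] V) := localLattice p L

theorem mem_smul_locSet {p : Nat.Primes} {g : LocalAut V p} {L : Submodule ℤ V}
    {x : ℚ_[p] ⊗[ℚ] V} : x ∈ g • locSet p L ↔ g⁻¹ x ∈ localLattice p L :=
  Set.mem_smul_set_iff_inv_smul_mem

/-- The lattice `ΣL` on `V` with localizations `Σ_p L_p`. -/
def glue (g : ∀ p : Nat.Primes, LocalAut V p) (L : Submodule ℤ V) : Submodule ℤ V where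
  carrier := {x | ∀ p : Nat.Primes, (g p)⁻¹ ((1 : ℚ_[p]) ⊗ₜ[ℚ] x) ∈ localLattice p L}
  add_mem' {x y} hx hy p := by
    rw [TensorProduct.tmul_add, map_add]
    exact add_mem (hx p) (hy p)
  zero_mem' p := by simp
  smul_mem' c x hx p := by
    rw [TensorProduct.tmul_smul, map_zsmul]
    exact (localLattice p L).smul_of_tower_mem c (hx p)

theorem nsmul_mem_of_dvd {R M : Type*} [Ring R] [AddCommGroup M] [Module R M] (S : Submodule R M)
    {m k : ℕ} (h : m ∣ k) {x : M} (hx : m • x ∈ S) : k • x ∈ S := by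
  obtain ⟨c, rfl⟩ := h
  rw [mul_comm, mul_smul]
  exact S.smul_of_tower_mem c hx

theorem exists_nsmul_mem_localLattice [FiniteDimensional ℚ V] (p : Nat.Primes) {L : Submodule ℤ V}
    (hL : Submodule.IsLattice ℚ L) (x : ℚ_[p] ⊗[ℚ] V) :
    ∃ m : ℕ, m ≠ 0 ∧ m • x ∈ localLattice p L := by
  obtain ⟨b, rfl⟩ := exists_basis_span_eq rfl L hL
  choose k hk using fun i => exists_norm_pow_mul_le_one p ((b.baseChange ℚ_[p]).repr x i)
  refine ⟨(p : ℕ) ^ ∑ i, k i, pow_ne_zero _ p.2.ne_zero,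
    (mem_localLattice_span_iff p b _).mpr fun i => ?_⟩
  have h1 : k i ≤ ∑ i, k i := Finset.single_le_sum (fun _ _ => Nat.zero_le _) (Finset.mem_univ i)
  rw [← Nat.cast_smul_eq_nsmul ℚ_[p], map_smul, Finsupp.smul_apply, smul_eq_mul,
    ← Nat.sub_add_cancel h1, pow_add]
  push_cast
  rw [mul_assoc, norm_mul]
  refine mul_le_one₀ ?_ (norm_nonneg _) (hk i)
  exact_mod_cast norm_natCast_le_one p ((p : ℕ) ^ _)

theorem exists_nsmul_apply_mem [FiniteDimensional ℚ V] (p : Nat.Primes) {L : Submodule ℤ V}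
    (hL : Submodule.IsLattice ℚ L) (g : LocalAut V p) :
    ∃ m : ℕ, m ≠ 0 ∧ ∀ x ∈ localLattice p L, m • g x ∈ localLattice p L := by
  obtain ⟨b, hb⟩ := exists_basis_span_eq rfl L hL
  choose m hm h using fun i => exists_nsmul_mem_localLattice p hL (g (b.baseChange ℚ_[p] i))
  refine ⟨∏ i, m i, Finset.prod_ne_zero_iff.mpr fun i _ => hm i, fun x hx => ?_⟩
  rw [hb, localLattice_span] at hx
  induction hx using Submodule.span_induction with
  | mem y hy =>
    obtain ⟨i, rfl⟩ := hy
    exact nsmul_mem_of_dvd _ (Finset.dvd_prod_of_mem m (Finset.mem_univ i)) (h i)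
  | zero => simp
  | add x y _ _ hx hy => rw [map_add, smul_add]; exact add_mem hx hy
  | smul r x _ hx =>
    have : g (r • x) = r • g x := by
      rw [← algebraMap_smul ℚ_[p] r x, map_smul, algebraMap_smul]
    rw [this, smul_comm]
    exact Submodule.smul_mem _ _ hx

theorem exists_nsmul_apply_mem_forall [FiniteDimensional ℚ V] {L : Submodule ℤ V}
    (hL : Submodule.IsLattice ℚ L) {g : ∀ p : Nat.Primes, LocalAut V p}
    (hg : ∀ᶠ p in cofinite, g p • locSet p L = locSet p L) :
    ∃ m : ℕ, m ≠ 0 ∧ ∀ p : Nat.Primes, ∀ x ∈ localLattice p L, m • g p x ∈ localLattice p L := by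
  choose m hm h using fun p => exists_nsmul_apply_mem p hL (g p)
  rw [eventually_cofinite] at hg
  refine ⟨∏ p ∈ hg.toFinset, m p, Finset.prod_ne_zero_iff.mpr fun p _ => hm p, fun p x hx => ?_⟩
  by_cases hp : p ∈ hg.toFinset
  · exact nsmul_mem_of_dvd _ (Finset.dvd_prod_of_mem m hp) (h p x hx)
  · have h1 : g p • locSet p L = locSet p L := by simpa using hp
    have h2 : g p x ∈ g p • locSet p L := Set.smul_mem_smul_set hx
    rw [h1] at h2
    exact (localLattice p L).smul_of_tower_mem _ h2

variable [FiniteDimensional ℚ V] {L : Submodule ℤ V} {g : ∀ p : Nat.Primes, LocalAut V p}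

theorem exists_nsmul_mem_glue (hL : Submodule.IsLattice ℚ L)
    (hg : ∀ᶠ p in cofinite, g p • locSet p L = locSet p L) :
    ∃ m : ℕ, m ≠ 0 ∧ ∀ p : Nat.Primes, ∀ x ∈ localLattice p L,
      m • (g p)⁻¹ x ∈ localLattice p L := by
  refine exists_nsmul_apply_mem_forall hL (g := g⁻¹) ?_
  filter_upwards [hg] with p hp
  rw [Pi.inv_apply, inv_smul_eq_iff, hp]

theorem isLattice_glue (hL : Submodule.IsLattice ℚ L)
    (hg : ∀ᶠ p in cofinite, g p • locSet p L = locSet p L) :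
    Submodule.IsLattice ℚ (glue g L) := by
  obtain ⟨m, hm, h1⟩ := exists_nsmul_apply_mem_forall hL hg
  obtain ⟨k, hk, h2⟩ := exists_nsmul_mem_glue hL hg
  constructor
  · have hle : (glue g L).map (LinearMap.lsmul ℤ V m) ≤ L := by
      rintro _ ⟨x, hx, rfl⟩
      rw [mem_iff_forall_localLattice hL]
      intro p
      have := h1 p _ (hx p)
      rw [← LinearEquiv.mul_apply, mul_inv_cancel, LinearEquiv.coe_one, id] at this
      simpa [TensorProduct.tmul_smul] using this
    have : IsNoetherian ℤ L := by
      have := hL.finite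
      infer_instance
    refine Submodule.fg_of_fg_map_injective (LinearMap.lsmul ℤ V m) (fun x y hxy => ?_)
      ((isNoetherian_of_le hle).noetherian ⊤ |> fun h => (Submodule.fg_top _).mp h)
    have : (m : ℚ) • x = (m : ℚ) • y := by
      simpa [Nat.cast_smul_eq_nsmul] using hxy
    exact smul_right_injective V (Nat.cast_ne_zero.mpr hm) this
  · rw [eq_top_iff, ← hL.span_eq_top, Submodule.span_le]
    intro x hx
    have h3 : k • x ∈ glue g L := fun p => by
      rw [TensorProduct.tmul_smul, map_nsmul]
      exact h2 p _ (tmul_mem_localLattice p hx)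
    have h4 : x = (k : ℚ)⁻¹ • k • x := by
      rw [← Nat.cast_smul_eq_nsmul ℚ, smul_smul, inv_mul_cancel₀ (Nat.cast_ne_zero.mpr hk),
        one_smul]
    rw [h4]
    exact Submodule.smul_mem _ _ (Submodule.subset_span h3)

/-- The localizations of `ΣL` are the prescribed ones.  An element of `Σ_p L_p` is approximated at
`p` by a global vector that is highly divisible at all other primes, coordinate by coordinate. -/
theorem locSet_glue (hL : Submodule.IsLattice ℚ L)
    (hg : ∀ᶠ p in cofinite, g p • locSet p L = locSet p L) (p : Nat.Primes) :
    locSet p (glue g L) = g p • locSet p L := by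
  obtain ⟨k, hk, h2⟩ := exists_nsmul_mem_glue hL hg
  apply Set.Subset.antisymm
  · intro x hx
    rw [mem_smul_locSet]
    change x ∈ localLattice p (glue g L) at hx
    induction hx using Submodule.span_induction with
    | mem y hy =>
      obtain ⟨z, hz, rfl⟩ := hy
      exact hz p
    | zero => simp
    | add x y _ _ hx hy => rw [map_add]; exact add_mem hx hy
    | smul r x _ hx =>
      rw [← algebraMap_smul ℚ_[p] r x, map_smul, algebraMap_smul]
      exact Submodule.smul_mem _ _ hx
  · intro s hs
    rw [mem_smul_locSet] at hs
    have hkL : ∀ x ∈ L, k • x ∈ glue g L := fun x hx q => by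
      rw [TensorProduct.tmul_smul, map_nsmul]
      exact h2 q _ (tmul_mem_localLattice q hx)
    obtain ⟨b, hb⟩ := exists_basis_span_eq rfl L hL
    have hk0 : (k : ℚ_[p]) ≠ 0 := Nat.cast_ne_zero.mpr hk
    choose r hr hr' using fun i =>
      exists_rat_approx p ((k : ℚ_[p])⁻¹ * (b.baseChange ℚ_[p]).repr s i)
    -- `k • x` approximates `s` modulo `k L_p` and lies in `k L_q` for `q ≠ p`
    set x : V := ∑ i, r i • b i with hx
    have hxr : ∀ i, b.repr x i = r i := fun i => by
      rw [hx, b.repr_sum_self]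
    set w : ℚ_[p] ⊗[ℚ] V := (1 : ℚ_[p]) ⊗ₜ[ℚ] x - (k : ℚ_[p])⁻¹ • s with hw
    have hwL : w ∈ localLattice p L := by
      rw [hb, mem_localLattice_span_iff]
      intro i
      have : (b.baseChange ℚ_[p]).repr w i =
          (r i : ℚ_[p]) - (k : ℚ_[p])⁻¹ * (b.baseChange ℚ_[p]).repr s i := by
        rw [hw, map_sub, map_smul]
        simp [hxr]
      rw [this]
      exact hr i
    have hkw : s + k • w = (1 : ℚ_[p]) ⊗ₜ[ℚ] (k • x) := by
      rw [hw, smul_sub, ← Nat.cast_smul_eq_nsmul ℚ_[p] k ((k : ℚ_[p])⁻¹ • s), smul_smul,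
        mul_inv_cancel₀ hk0, one_smul, TensorProduct.tmul_smul]
      abel
    have hkx : k • x ∈ glue g L := by
      intro q
      by_cases hq : q = p
      · subst hq
        rw [← hkw, map_add, map_nsmul]
        exact add_mem hs (h2 q w hwL)
      · rw [TensorProduct.tmul_smul, map_nsmul]
        refine h2 q _ ?_
        rw [hb, mem_localLattice_span_iff]
        intro i
        simpa [hxr] using hr' i q hq
    have : s = (1 : ℚ_[p]) ⊗ₜ[ℚ] (k • x) - k • w := by rw [← hkw]; abel
    rw [this]
    exact sub_mem (tmul_mem_localLattice p hkx) (nsmul_mem_localLattice p hkL hwL)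

end SpinorGenus

/-! ### The adelic orthogonal group -/

namespace SpinorGenus

open Filter
open scoped Pointwise

variable {V : Type*} [AddCommGroup V] [Module ℚ V]

section Global

/-- The automorphism of `V_p` induced by an automorphism of `V`. -/
noncomputable def globalAut (σ : V ≃ₗ[ℚ] V) (p : Nat.Primes) : LocalAut V p :=
  σ.baseChange ℚ ℚ_[p] V V

theorem globalAut_tmul (σ : V ≃ₗ[ℚ] V) (p : Nat.Primes) (a : ℚ_[p]) (x : V) :
    globalAut σ p (a ⊗ₜ x) = a ⊗ₜ σ x := rfl

theorem localAut_ext {p : Nat.Primes} {g h : LocalAut V p}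
    (H : ∀ x : V, g ((1 : ℚ_[p]) ⊗ₜ[ℚ] x) = h ((1 : ℚ_[p]) ⊗ₜ[ℚ] x)) : g = h := by
  apply LinearEquiv.toLinearMap_injective
  ext x
  exact H x

theorem globalAut_mul (σ τ : V ≃ₗ[ℚ] V) (p : Nat.Primes) :
    globalAut (σ * τ) p = globalAut σ p * globalAut τ p :=
  localAut_ext fun _ => rfl

theorem globalAut_one (p : Nat.Primes) : globalAut (1 : V ≃ₗ[ℚ] V) p = 1 :=
  localAut_ext fun _ => rfl

theorem globalAut_inv (σ : V ≃ₗ[ℚ] V) (p : Nat.Primes) :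
    globalAut σ⁻¹ p = (globalAut σ p)⁻¹ :=
  eq_inv_of_mul_eq_one_left (by rw [← globalAut_mul, inv_mul_cancel, globalAut_one])

theorem globalAut_mem_orthGroup {Q : QuadraticForm ℚ V} {σ : V ≃ₗ[ℚ] V} (hσ : σ ∈ orthGroup Q)
    (p : Nat.Primes) : globalAut σ p ∈ orthGroup (localForm p Q) := by
  have : (localForm p Q).comp (globalAut σ p).toLinearMap = localForm p Q := by
    apply baseChange_ext
    intro m
    rw [QuadraticMap.comp_apply, LinearEquiv.coe_coe, globalAut_tmul, QuadraticForm.baseChange_tmul,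
      QuadraticForm.baseChange_tmul, hσ]
  exact fun x => congrArg (fun q : QuadraticForm ℚ_[p] (ℚ_[p] ⊗[ℚ] V) => q x) this

/-- The image `σ L` of a lattice under an isomorphism of rational spaces. -/
abbrev mapLattice {W : Type*} [AddCommGroup W] [Module ℚ W] (σ : V ≃ₗ[ℚ] W)
    (L : Submodule ℤ V) : Submodule ℤ W :=
  L.map (σ.toLinearMap.restrictScalars ℤ)

theorem isLattice_mapLattice {W : Type*} [AddCommGroup W] [Module ℚ W] (σ : V ≃ₗ[ℚ] W)
    {L : Submodule ℤ V} (hL : Submodule.IsLattice ℚ L) :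
    Submodule.IsLattice ℚ (mapLattice σ L) where
  fg := hL.fg.map _
  span_eq_top := by
    have : (mapLattice σ L : Set W) = σ.toLinearMap '' (L : Set V) := rfl
    rw [this, Submodule.span_image, hL.span_eq_top, Submodule.map_top, LinearEquiv.range]

theorem localLattice_map {W : Type*} [AddCommGroup W] [Module ℚ W] (σ : V →ₗ[ℚ] W)
    (L : Submodule ℤ V) (p : ℕ) [Fact p.Prime] :
    (localLattice p (L.map (σ.restrictScalars ℤ)) : Set (ℚ_[p] ⊗[ℚ] W)) =
      σ.baseChange ℚ_[p] '' (localLattice p L : Set (ℚ_[p] ⊗[ℚ] V)) := by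
  have h1 : ((σ.baseChange ℚ_[p]).restrictScalars ℤ_[p]) '' (localLattice p L : Set _) =
      ((localLattice p L).map ((σ.baseChange ℚ_[p]).restrictScalars ℤ_[p]) :
        Submodule ℤ_[p] (ℚ_[p] ⊗[ℚ] W)) := rfl
  have h2 : σ.baseChange ℚ_[p] '' (localLattice p L : Set (ℚ_[p] ⊗[ℚ] V)) =
    ((σ.baseChange ℚ_[p]).restrictScalars ℤ_[p]) '' (localLattice p L : Set _) := rfl
  rw [h2, h1, localLattice, localLattice, Submodule.map_span, ← Set.image_comp]
  congr 2
  ext y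
  constructor
  · rintro ⟨_, ⟨x, hx, rfl⟩, rfl⟩
    exact ⟨x, hx, by simp⟩
  · rintro ⟨x, hx, rfl⟩
    exact ⟨σ x, ⟨x, hx, rfl⟩, by simp⟩

theorem locSet_mapLattice (σ : V ≃ₗ[ℚ] V) (L : Submodule ℤ V) (p : Nat.Primes) :
    locSet p (mapLattice σ L) = globalAut σ p • locSet p L :=
  localLattice_map σ.toLinearMap L p

end Global

/-- The adelic orthogonal group `O_A(V)`: families of local isometries that fix `L_p` for almost
all `p`, for one or, equivalently, every lattice `L` on `V`. -/
def adelicOrthGroup (Q : QuadraticForm ℚ V) : Subgroup (∀ p : Nat.Primes, LocalAut V p) where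
  carrier := {g | (∀ p : Nat.Primes, g p ∈ orthGroup (localForm p Q)) ∧
    ∀ L : Submodule ℤ V, Submodule.IsLattice ℚ L →
      ∀ᶠ p in cofinite, g p • locSet p L = locSet p L}
  mul_mem' {a b} ha hb := by
    refine ⟨fun p => mul_mem (ha.1 p) (hb.1 p), fun L hL => ?_⟩
    filter_upwards [ha.2 L hL, hb.2 L hL] with p h1 h2
    rw [Pi.mul_apply, mul_smul, h2, h1]
  one_mem' := ⟨fun p => one_mem _, fun L _ => Eventually.of_forall fun p => one_smul _ _⟩
  inv_mem' {a} ha := by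
    refine ⟨fun p => inv_mem (ha.1 p), fun L hL => ?_⟩
    filter_upwards [ha.2 L hL] with p h1
    rw [Pi.inv_apply, inv_smul_eq_iff, h1]

theorem mem_adelicOrthGroup_of_lattice {Q : QuadraticForm ℚ V}
    {g : ∀ p : Nat.Primes, LocalAut V p} (hg : ∀ p : Nat.Primes, g p ∈ orthGroup (localForm p Q))
    {L : Submodule ℤ V} (hL : Submodule.IsLattice ℚ L)
    (h : ∀ᶠ p in cofinite, g p • locSet p L = locSet p L) : g ∈ adelicOrthGroup Q := by
  refine ⟨hg, fun K hK => ?_⟩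
  filter_upwards [h, eventually_localLattice_eq hL hK] with p h1 h2
  simpa only [locSet, h2] using h1

theorem globalAut_mem_adelicOrthGroup {Q : QuadraticForm ℚ V} {σ : V ≃ₗ[ℚ] V}
    (hσ : σ ∈ orthGroup Q) : globalAut σ ∈ adelicOrthGroup Q := by
  refine ⟨globalAut_mem_orthGroup hσ, fun L hL => ?_⟩
  filter_upwards [eventually_localLattice_eq (isLattice_mapLattice σ hL) hL] with p hp
  rw [← locSet_mapLattice, locSet, hp]

/-- The diagonal image of `O(V)`. -/
def globalSubgroup (Q : QuadraticForm ℚ V) : Subgroup (adelicOrthGroup Q) where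
  carrier := {g | ∃ σ ∈ orthGroup Q, ∀ p, g.1 p = globalAut σ p}
  mul_mem' := by
    rintro a b ⟨σ, hσ, h1⟩ ⟨τ, hτ, h2⟩
    exact ⟨σ * τ, mul_mem hσ hτ, fun p => by
      rw [globalAut_mul, ← h1, ← h2]; rfl⟩
  one_mem' := ⟨1, one_mem _, fun p => (globalAut_one p).symm⟩
  inv_mem' := by
    rintro a ⟨σ, hσ, h1⟩
    exact ⟨σ⁻¹, inv_mem hσ, fun p => by rw [globalAut_inv, ← h1]; rfl⟩

/-- The adelic spinorial kernel `O'_A(V)`: every component has trivial spinor norm. -/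
def spinorSubgroup (Q : QuadraticForm ℚ V) : Subgroup (adelicOrthGroup Q) where
  carrier := {g | ∀ p : Nat.Primes, g.1 p ∈ spinorGroup (localForm p Q)}
  mul_mem' ha hb p := mul_mem (ha p) (hb p)
  one_mem' _ := one_mem _
  inv_mem' ha p := inv_mem (ha p)

/-- The stabilizer `O_A(L)` of a lattice: `Σ_p L_p = L_p` at every `p`. -/
def latticeStabilizer (Q : QuadraticForm ℚ V) (L : Submodule ℤ V) :
    Subgroup (adelicOrthGroup Q) where
  carrier := {g | ∀ p, g.1 p • locSet p L = locSet p L}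
  mul_mem' {a b} ha hb p := by
    change (a.1 p * b.1 p) • _ = _
    rw [mul_smul, hb, ha]
  one_mem' p := one_smul _ _
  inv_mem' {a} ha p := by
    change (a.1 p)⁻¹ • _ = _
    rw [inv_smul_eq_iff, ha]

/-- A positive definite space, localized, has an anisotropic orthogonal basis. -/
theorem exists_orthogonal_basis_localForm [FiniteDimensional ℚ V] {Q : QuadraticForm ℚ V}
    (hQ : Q.PosDef) (p : Nat.Primes) :
    ∃ b : Module.Basis (Fin (Module.finrank ℚ V)) ℚ_[p] (ℚ_[p] ⊗[ℚ] V),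
      (∀ i j, i ≠ j → QuadraticMap.polar (localForm p Q) (b i) (b j) = 0) ∧
        ∀ i, localForm p Q (b i) ≠ 0 := by
  obtain ⟨b, hb⟩ := LinearMap.BilinForm.exists_orthogonal_basis
    (QuadraticForm.associated_isSymm ℚ Q)
  refine ⟨b.baseChange ℚ_[p], fun i j hij => ?_, fun i => ?_⟩
  · have h1 : QuadraticMap.polar Q (b i) (b j) = 0 := by
      have h2 : QuadraticMap.associated Q (b i) (b j) = 0 := hb hij
      rw [← QuadraticMap.polarBilin_apply_apply, ← QuadraticMap.two_nsmul_associated ℚ Q]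
      simp only [LinearMap.smul_apply, h2, smul_zero]
    have h3 := congrArg (Rat.cast : ℚ → ℚ_[p]) h1
    simp only [QuadraticMap.polar, Module.Basis.baseChange_apply, ← TensorProduct.tmul_add,
      QuadraticForm.baseChange_tmul] at h3 ⊢
    push_cast at h3
    simpa [Algebra.smul_def] using h3
  · rw [Module.Basis.baseChange_apply, QuadraticForm.baseChange_tmul]
    have := (hQ (b i) (b.ne_zero i)).ne'
    simpa [Algebra.smul_def] using this

theorem commutator_mem_spinorSubgroup [FiniteDimensional ℚ V] {Q : QuadraticForm ℚ V}
    (hQ : Q.PosDef) (g h : adelicOrthGroup Q) : g * h * g⁻¹ * h⁻¹ ∈ spinorSubgroup Q := by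
  intro p
  obtain ⟨b, hb, hb0⟩ := exists_orthogonal_basis_localForm hQ p
  obtain ⟨l, hl, hl'⟩ := exists_symmetryProd_eq _ b hb hb0 (g.2.1 p)
  obtain ⟨m, hm, hm'⟩ := exists_symmetryProd_eq _ b hb hb0 (h.2.1 p)
  exact commutator_mem_spinorGroup hl hm hl' hm'

/-! ### Genera and spinor genera as orbits -/

theorem mem_gen_of_locSet {Q : QuadraticForm ℚ V} {L K : Submodule ℤ V}
    (hK : Submodule.IsLattice ℚ K) (h : ∀ p : Nat.Primes, ∃ S ∈ orthGroup (localForm p Q),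
      locSet p K = S • locSet p L) :
    K ∈ gen Q L := by
  refine ⟨hK, fun p hp => ?_⟩
  obtain ⟨S, hS, h⟩ := h ⟨p, hp.out⟩
  exact ⟨⟨S, hS⟩, h⟩

theorem mem_cls_iff {Q : QuadraticForm ℚ V} {L K : Submodule ℤ V} :
    K ∈ cls Q L ↔ ∃ σ ∈ orthGroup Q, K = mapLattice σ L := by
  constructor
  · rintro ⟨σ, h⟩
    exact ⟨σ.toLinearEquiv, fun x => σ.map_app x, SetLike.coe_injective h⟩
  · rintro ⟨σ, hσ, rfl⟩
    exact ⟨⟨σ, hσ⟩, rfl⟩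

theorem mem_spn_iff_of_locSet {Q : QuadraticForm ℚ V} {L K : Submodule ℤ V} :
    K ∈ spn Q L ↔ Submodule.IsLattice ℚ K ∧ ∃ σ ∈ orthGroup Q, ∀ p : Nat.Primes,
      ∃ S ∈ spinorGroup (localForm p Q), locSet p K = globalAut σ p • S • locSet p L := by
  constructor
  · rintro ⟨hK, σ, h⟩
    refine ⟨hK, σ.toLinearEquiv, fun x => σ.map_app x, fun p => ?_⟩
    obtain ⟨S, hS, h⟩ := h p
    exact ⟨S.toLinearEquiv, mem_spinorKernel_iff.mp hS, h⟩
  · rintro ⟨hK, σ, hσ, h⟩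
    refine ⟨hK, ⟨σ, hσ⟩, fun p hp => ?_⟩
    obtain ⟨S, hS, h⟩ := h ⟨p, hp.out⟩
    exact ⟨⟨S, spinorGroup_le_orthGroup _ hS⟩, mem_spinorKernel_iff.mpr hS, h⟩

section Orbits

variable [FiniteDimensional ℚ V] {Q : QuadraticForm ℚ V} {L : Submodule ℤ V}

theorem glue_isLattice (hL : Submodule.IsLattice ℚ L) (g : adelicOrthGroup Q) :
    Submodule.IsLattice ℚ (glue g.1 L) :=
  isLattice_glue hL (g.2.2 L hL)

theorem glue_locSet (hL : Submodule.IsLattice ℚ L) (g : adelicOrthGroup Q) (p : Nat.Primes) :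
    locSet p (glue g.1 L) = g.1 p • locSet p L :=
  locSet_glue hL (g.2.2 L hL) p

theorem eq_of_locSet_eq {K : Submodule ℤ V} (hL : Submodule.IsLattice ℚ L)
    (hK : Submodule.IsLattice ℚ K) (h : ∀ p, locSet p L = locSet p K) : L = K :=
  eq_of_localLattice_eq hL hK fun p => SetLike.coe_injective (h p)

theorem glue_mul_of_mem_stabilizer (hL : Submodule.IsLattice ℚ L) (g : adelicOrthGroup Q)
    {s : adelicOrthGroup Q} (hs : s ∈ latticeStabilizer Q L) :
    glue (g * s).1 L = glue g.1 L := by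
  refine eq_of_locSet_eq (glue_isLattice hL _) (glue_isLattice hL _) fun p => ?_
  rw [glue_locSet hL, glue_locSet hL]
  change (g.1 p * s.1 p) • _ = _
  rw [mul_smul, hs p]

theorem glue_globalAut_mul (hL : Submodule.IsLattice ℚ L) (g : adelicOrthGroup Q)
    {o : adelicOrthGroup Q} {σ : V ≃ₗ[ℚ] V} (ho : ∀ p, o.1 p = globalAut σ p) :
    glue (o * g).1 L = mapLattice σ (glue g.1 L) := by
  refine eq_of_locSet_eq (glue_isLattice hL _)
    (isLattice_mapLattice σ (glue_isLattice hL _)) fun p => ?_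
  rw [glue_locSet hL, locSet_mapLattice, glue_locSet hL, ← ho]
  exact mul_smul _ _ _

theorem mem_gen_iff (hL : Submodule.IsLattice ℚ L) {K : Submodule ℤ V} :
    K ∈ gen Q L ↔ ∃ g : adelicOrthGroup Q, K = glue g.1 L := by
  constructor
  · rintro ⟨hK, h⟩
    choose S hS using fun p : Nat.Primes => h p
    let g : ∀ p : Nat.Primes, LocalAut V p := fun p => (S p).toLinearEquiv
    have hg : ∀ p, locSet p K = g p • locSet p L := hS
    have hgJ : g ∈ adelicOrthGroup Q := by
      refine mem_adelicOrthGroup_of_lattice (fun p x => (S p).map_app x) hL ?_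
      filter_upwards [eventually_localLattice_eq hK hL] with p hp
      rw [← hg, locSet, hp]
    refine ⟨⟨g, hgJ⟩, eq_of_locSet_eq hK (glue_isLattice hL ⟨g, hgJ⟩) fun p => ?_⟩
    rw [hg, glue_locSet hL]
  · rintro ⟨g, rfl⟩
    exact mem_gen_of_locSet (glue_isLattice hL g) fun p => ⟨g.1 p, g.2.1 p, glue_locSet hL g p⟩

/-- `ΣL` and `TL` belong to the same spinor genus if and only if `Σ` and `T` lie in the same coset
of `O(V) O'_A(V) O_A(L)`. -/
theorem glue_mem_spn_iff (hQ : Q.PosDef) (hL : Submodule.IsLattice ℚ L) (g h : adelicOrthGroup Q) :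
    glue g.1 L ∈ spn Q (glue h.1 L) ↔
      h⁻¹ * g ∈ globalSubgroup Q ⊔ spinorSubgroup Q ⊔ latticeStabilizer Q L := by
  have hK := commutator_mem_spinorSubgroup hQ
  have hOn : (globalSubgroup Q ⊔ spinorSubgroup Q).Normal :=
    normal_of_commutator_mem hK le_sup_right
  have hKn : (spinorSubgroup Q).Normal := normal_of_commutator_mem hK le_rfl
  rw [mem_spn_iff_of_locSet]
  constructor
  · rintro ⟨-, σ, hσ, H⟩
    choose S hS H using H
    simp only [glue_locSet hL] at H
    set o : adelicOrthGroup Q := ⟨globalAut σ, globalAut_mem_adelicOrthGroup hσ⟩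
    have hSJ : S ∈ adelicOrthGroup Q := by
      refine mem_adelicOrthGroup_of_lattice (fun p => spinorGroup_le_orthGroup _ (hS p)) hL ?_
      filter_upwards [h.2.2 L hL, g.2.2 L hL, o.2.2 L hL] with p h1 h2 h3
      have h4 := H p
      rw [h1, h2, ← inv_smul_eq_iff, inv_smul_eq_iff.mpr h3.symm] at h4
      exact h4.symm
    set k : adelicOrthGroup Q := ⟨S, hSJ⟩
    have hs : h⁻¹ * k⁻¹ * o⁻¹ * g ∈ latticeStabilizer Q L := fun p => by
      change ((h.1 p)⁻¹ * (S p)⁻¹ * (globalAut σ p)⁻¹ * g.1 p) • _ = _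
      rw [mul_smul, H p, mul_smul, inv_smul_smul, mul_smul, inv_smul_smul, inv_smul_smul]
    have hok : h⁻¹ * (o * k) * h ∈ globalSubgroup Q ⊔ spinorSubgroup Q := by
      have := hOn.conj_mem (o * k)
        (mul_mem (Subgroup.mem_sup_left ⟨σ, hσ, fun p => rfl⟩) (Subgroup.mem_sup_right hS)) h⁻¹
      rwa [inv_inv] at this
    have : h⁻¹ * g = h⁻¹ * (o * k) * h * (h⁻¹ * k⁻¹ * o⁻¹ * g) := by group
    rw [this]
    exact mul_mem (Subgroup.mem_sup_left hok) (Subgroup.mem_sup_right hs)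
  · intro H
    have H' : h⁻¹ * g ∈ ((globalSubgroup Q ⊔ spinorSubgroup Q ⊔ latticeStabilizer Q L :
      Subgroup (adelicOrthGroup Q)) : Set (adelicOrthGroup Q)) := H
    rw [Subgroup.normal_mul] at H'
    obtain ⟨x, hx, s, hs, hxs⟩ := Set.mem_mul.mp H'
    have hx' : h * x * h⁻¹ ∈ ((globalSubgroup Q ⊔ spinorSubgroup Q :
      Subgroup (adelicOrthGroup Q)) : Set (adelicOrthGroup Q)) := hOn.conj_mem x hx h
    rw [Subgroup.mul_normal] at hx'
    obtain ⟨o, ⟨σ, hσ, ho⟩, k, hk, hok⟩ := Set.mem_mul.mp hx'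
    have hg : g = o * (k * (h * s)) := by
      have : g = h * (x * s) := by rw [hxs]; group
      rw [this, ← mul_assoc o, hok]
      group
    refine ⟨glue_isLattice hL g, σ, hσ, fun p => ⟨k.1 p, hk p, ?_⟩⟩
    rw [glue_locSet hL, glue_locSet hL, ← ho p]
    conv_lhs => rw [hg]
    change (o.1 p * (k.1 p * (h.1 p * s.1 p))) • _ = _
    rw [mul_smul, mul_smul, mul_smul, hs p]

end Orbits

end SpinorGenus

/-! ### Gram matrices and determinants in a genus -/

namespace SpinorGenus

open Filter
open scoped Pointwise

section Gram

variable {K : Type*} [Field K] {U : Type*} [AddCommGroup U] [Module K U]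
variable {ι : Type*} [Fintype ι] [DecidableEq ι]

/-- The Gram matrix of the polar form, with entries `2 B(b i, b j)`. -/
noncomputable def gram (Q : QuadraticForm K U) (b : Module.Basis ι K U) : Matrix ι ι K :=
  LinearMap.BilinForm.toMatrix b Q.polarBilin

theorem gram_apply (Q : QuadraticForm K U) (b : Module.Basis ι K U) (i j : ι) :
    gram Q b i j = QuadraticMap.polar Q (b i) (b j) := by
  simp [gram, LinearMap.BilinForm.toMatrix_apply]

theorem det_gram_eq (Q : QuadraticForm K U) (b c : Module.Basis ι K U) :
    (gram Q c).det = (b.det c) ^ 2 * (gram Q b).det := by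
  rw [gram, gram, ← LinearMap.BilinForm.toMatrix_mul_basis_toMatrix b c, Matrix.det_mul,
    Matrix.det_mul, Matrix.det_transpose, Module.Basis.det_apply]
  ring

theorem gram_map (Q : QuadraticForm K U) (b : Module.Basis ι K U) {g : U ≃ₗ[K] U}
    (hg : g ∈ orthGroup Q) : gram Q (b.map g) = gram Q b := by
  ext i j
  simp only [gram_apply, Module.Basis.map_apply, QuadraticMap.polar, ← map_add, hg _]

end Gram

variable {V : Type*} [AddCommGroup V] [Module ℚ V]
variable {ι : Type*} [Fintype ι] [DecidableEq ι]

theorem det_gram_ne_zero {Q : QuadraticForm ℚ V} (hQ : Q.PosDef) (b : Module.Basis ι ℚ V) :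
    (gram Q b).det ≠ 0 := by
  have : FiniteDimensional ℚ V := b.finiteDimensional_of_finite
  have h0 : ∀ x : V, QuadraticMap.polar Q x x = 0 → x = 0 := fun x h => by
    rw [QuadraticMap.polar_self] at h
    by_contra hx
    have := hQ x hx
    rw [two_nsmul] at h
    linarith
  have hnd : LinearMap.BilinForm.Nondegenerate Q.polarBilin :=
    ⟨fun x h => h0 x (h x), fun x h => h0 x (h x)⟩
  exact (LinearMap.BilinForm.nondegenerate_iff_det_ne_zero b).mp hnd

theorem polar_tmul (Q : QuadraticForm ℚ V) (p : ℕ) [Fact p.Prime] (x y : V) :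
    QuadraticMap.polar (localForm p Q) (1 ⊗ₜ x) (1 ⊗ₜ y) = (QuadraticMap.polar Q x y : ℚ) := by
  simp only [QuadraticMap.polar, ← TensorProduct.tmul_add, QuadraticForm.baseChange_tmul]
  push_cast
  simp [Algebra.smul_def]

theorem gram_baseChange (Q : QuadraticForm ℚ V) (p : ℕ) [Fact p.Prime] (b : Module.Basis ι ℚ V) :
    gram (localForm p Q) (b.baseChange ℚ_[p]) = (gram Q b).map (Rat.castHom ℚ_[p]) := by
  ext i j
  rw [gram_apply, Module.Basis.baseChange_apply, Module.Basis.baseChange_apply, polar_tmul,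
    Matrix.map_apply, gram_apply]
  rfl

theorem norm_det_le_one {p : ℕ} [Fact p.Prime] {A : Matrix ι ι ℚ_[p]} (h : ∀ i j, ‖A i j‖ ≤ 1) :
    ‖A.det‖ ≤ 1 := by
  let A' : Matrix ι ι ℤ_[p] := fun i j => ⟨A i j, h i j⟩
  have : A = PadicInt.Coe.ringHom.mapMatrix A' := rfl
  rw [this, ← RingHom.map_det]
  exact PadicInt.norm_le_one _

/-- If `g` is a local isometry with `K_p ⊆ g L_p`, then the determinant of a basis of `K` with
respect to a basis of `L` is a `p`-adic integer: up to sign it is the determinant with respect to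
the `g`-image of the basis of `L`, as comparison of Gram determinants shows. -/
theorem norm_basis_det_le_one {Q : QuadraticForm ℚ V} (hQ : Q.PosDef) {p : Nat.Primes}
    (b c : Module.Basis ι ℚ V) {g : LocalAut V p} (hg : g ∈ orthGroup (localForm p Q))
    (h : locSet p (Submodule.span ℤ (Set.range c)) ⊆
      g • locSet p (Submodule.span ℤ (Set.range b))) :
    ‖((b.det c : ℚ) : ℚ_[p])‖ ≤ 1 := by
  set bp := b.baseChange ℚ_[p]
  set cp := c.baseChange ℚ_[p]
  have h1 := det_gram_eq (localForm p Q) (bp.map g) cp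
  rw [gram_map _ _ hg, gram_baseChange, gram_baseChange, ← RingHom.mapMatrix_apply,
    ← RingHom.mapMatrix_apply, ← RingHom.map_det, ← RingHom.map_det, det_gram_eq Q b c,
    map_mul, map_pow] at h1
  have h2 : (Rat.castHom ℚ_[p]) (gram Q b).det ≠ 0 :=
    (map_ne_zero _).mpr (det_gram_ne_zero hQ b)
  have h3 := mul_right_cancel₀ h2 h1
  have h4 : ‖(bp.map g).det cp‖ ≤ 1 := by
    rw [Module.Basis.det_apply]
    refine norm_det_le_one fun i j => ?_
    rw [Module.Basis.toMatrix_apply]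
    have h5 : cp j ∈ g • locSet p (Submodule.span ℤ (Set.range b)) := by
      refine h ?_
      rw [Module.Basis.baseChange_apply]
      exact tmul_mem_localLattice p (Submodule.subset_span ⟨j, rfl⟩)
    exact (mem_localLattice_span_iff p b _).mp (mem_smul_locSet.mp h5) i
  have h6 := congrArg norm h3
  rw [norm_pow, norm_pow] at h6
  have h7 := (pow_left_inj₀ (norm_nonneg _) (norm_nonneg _) two_ne_zero).mp h6
  rw [← h7] at h4
  exact h4

theorem abs_basis_det_eq_one {Q : QuadraticForm ℚ V} (hQ : Q.PosDef) (b c : Module.Basis ι ℚ V)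
    {g : ∀ p : Nat.Primes, LocalAut V p} (hg : ∀ p : Nat.Primes, g p ∈ orthGroup (localForm p Q))
    (h : ∀ p, locSet p (Submodule.span ℤ (Set.range c)) =
      g p • locSet p (Submodule.span ℤ (Set.range b))) :
    |b.det c| = 1 := by
  obtain ⟨z, hz⟩ := exists_int_eq_of_norm_le_one fun p =>
    norm_basis_det_le_one hQ b c (hg p) (h p).le
  obtain ⟨w, hw⟩ := exists_int_eq_of_norm_le_one fun p =>
    norm_basis_det_le_one hQ c b (inv_mem (hg p)) (by
      rw [h p, inv_smul_smul])
  have h1 : z * w = 1 := by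
    have : b.det c * c.det b = 1 := by
      rw [Module.Basis.det_apply, Module.Basis.det_apply, ← Matrix.det_mul,
        Module.Basis.toMatrix_mul_toMatrix_flip, Matrix.det_one]
    rw [hz, hw] at this
    exact_mod_cast this
  rw [hz]
  rcases Int.eq_one_or_neg_one_of_mul_eq_one h1 with rfl | rfl <;> simp

section Index

theorem glue_mono {L M : Submodule ℤ V} (h : M ≤ L) (g : ∀ p : Nat.Primes, LocalAut V p) :
    glue g M ≤ glue g L :=
  fun _ hx p => Submodule.span_mono (Set.image_mono h) (hx p)

theorem relIndex_span_eq (b c : Module.Basis ι ℚ V)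
    (h : Submodule.span ℤ (Set.range c) ≤ Submodule.span ℤ (Set.range b)) :
    (((Submodule.span ℤ (Set.range c)).toAddSubgroup.relIndex
      (Submodule.span ℤ (Set.range b)).toAddSubgroup : ℕ) : ℚ) = |b.det c| :=
  AddSubgroup.relIndex_eq_abs_det _ _ h c b (Submodule.span_int_eq_addSubgroupClosure _)
    (Submodule.span_int_eq_addSubgroupClosure _)

variable [FiniteDimensional ℚ V] {Q : QuadraticForm ℚ V} {L M : Submodule ℤ V}

/-- `[ΣL : ΣM] = [L : M]`. -/
theorem relIndex_glue (hQ : Q.PosDef) (hL : Submodule.IsLattice ℚ L)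
    (hM : Submodule.IsLattice ℚ M) (h : M ≤ L) (g : adelicOrthGroup Q) :
    (glue g.1 M).toAddSubgroup.relIndex (glue g.1 L).toAddSubgroup =
      M.toAddSubgroup.relIndex L.toAddSubgroup := by
  obtain ⟨b, hb⟩ := exists_basis_span_eq rfl L hL
  obtain ⟨c, hc⟩ := exists_basis_span_eq rfl M hM
  obtain ⟨b', hb'⟩ := exists_basis_span_eq rfl _ (glue_isLattice hL g)
  obtain ⟨c', hc'⟩ := exists_basis_span_eq rfl _ (glue_isLattice hM g)
  have h1 : |b.det b'| = 1 := abs_basis_det_eq_one hQ b b' g.2.1 fun p => by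
    rw [← hb, ← hb', glue_locSet hL]
  have h2 : |c.det c'| = 1 := abs_basis_det_eq_one hQ c c' g.2.1 fun p => by
    rw [← hc, ← hc', glue_locSet hM]
  have h3 : b.det b' * b'.det c' = b.det c * c.det c' := by
    simp only [Module.Basis.det_apply, ← Matrix.det_mul, Module.Basis.toMatrix_mul_toMatrix]
  have h4 := congrArg abs h3
  rw [abs_mul, abs_mul, h1, h2, one_mul, mul_one] at h4
  have h5 := glue_mono h g.1
  have h6 := relIndex_span_eq b c (hb ▸ hc ▸ h)
  have h7 := relIndex_span_eq b' c' (hb' ▸ hc' ▸ h5)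
  rw [← hb, ← hc] at h6
  rw [← hb', ← hc'] at h7
  have : (((glue g.1 M).toAddSubgroup.relIndex (glue g.1 L).toAddSubgroup : ℕ) : ℚ) =
      (M.toAddSubgroup.relIndex L.toAddSubgroup : ℕ) := by rw [h6, h7, h4]
  exact_mod_cast this

theorem det_gram_glue (hQ : Q.PosDef) (b c : Module.Basis ι ℚ V)
    (g : adelicOrthGroup Q)
    (h : glue g.1 (Submodule.span ℤ (Set.range b)) = Submodule.span ℤ (Set.range c)) :
    (gram Q c).det = (gram Q b).det := by
  have h1 : |b.det c| = 1 := abs_basis_det_eq_one hQ b c g.2.1 fun p => by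
    rw [← h, glue_locSet (isLattice_span b)]
  rw [det_gram_eq Q b c, ← sq_abs, h1, one_pow, one_mul]

end Index

/-! ### Reduction of ternary forms -/

/-- The determinant bound for a reduced ternary form with diagonal `a ≤ b ≤ c` and off-diagonal
polar values `r`, `s`, `t`. Only `r s t` can make the determinant small beyond the pairwise bounds,
and when it is negative the minimality of the third vector bounds `|r| + |s| + |t|`. -/
theorem reduced_det_bound {a b c r s t : ℚ} (ha : 0 < a) (hab : a ≤ b) (hbc : b ≤ c)
    (hr : |r| ≤ a) (hs : |s| ≤ a) (ht : |t| ≤ b)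
    (h : r * s * t < 0 → |r| + |s| + |t| ≤ a + b) :
    a * b * c ≤ 4 * (a * b * c) + r * s * t - a * t ^ 2 - b * s ^ 2 - c * r ^ 2 := by
  rw [← sq_abs t, ← sq_abs s, ← sq_abs r]
  have hb : 0 < b := ha.trans_le hab
  have hc : 0 < c := hb.trans_le hbc
  have hR := abs_nonneg r
  have hS := abs_nonneg s
  have hT := abs_nonneg t
  have h1 : a * |t| ^ 2 ≤ a * c * |t| := by
    have : |t| * |t| ≤ c * |t| := mul_le_mul_of_nonneg_right (ht.trans hbc) hT
    nlinarith
  have h2 : b * |s| ^ 2 ≤ a * c * |s| := by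
    have h3 : |s| * |s| ≤ a * |s| := mul_le_mul_of_nonneg_right hs hS
    have h4 : b * (|s| * |s|) ≤ c * (a * |s|) := mul_le_mul hbc h3 (by positivity) hc.le
    linarith
  have h3 : c * |r| ^ 2 ≤ a * c * |r| := by
    have h3 : |r| * |r| ≤ a * |r| := mul_le_mul_of_nonneg_right hr hR
    nlinarith
  have hac : 0 < a * c := by positivity
  rcases lt_or_ge (r * s * t) 0 with hneg | hpos
  · have h4 : a * c * (|r| + |s| + |t|) ≤ a * c * (a + b) :=
      mul_le_mul_of_nonneg_left (h hneg) hac.le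
    have h5 : a * c * a ≤ a * c * b := mul_le_mul_of_nonneg_left hab hac.le
    have h6 : -(r * s * t) ≤ a * b * c := by
      have : -(r * s * t) = |r| * |s| * |t| := by
        rw [← abs_mul, ← abs_mul, abs_of_neg hneg]
      rw [this]
      calc |r| * |s| * |t| ≤ a * a * b := by gcongr
        _ ≤ a * c * b := by gcongr; exact hab.trans hbc
        _ = a * b * c := by ring
    nlinarith
  · have h4 : a * c * |r| ≤ a * c * b := mul_le_mul_of_nonneg_left (hr.trans hab) hac.le
    have h5 : a * c * |s| ≤ a * c * b := mul_le_mul_of_nonneg_left (hs.trans hab) hac.le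
    have h6 : a * |t| ^ 2 ≤ a * c * b := by
      have := mul_le_mul_of_nonneg_left ht hac.le
      linarith
    nlinarith

theorem span_map_transvection (b : Module.Basis ι ℚ V) (i : ι) {w : V} (hw : b.coord i w = 0)
    (hwL : w ∈ Submodule.span ℤ (Set.range b)) :
    Submodule.span ℤ (Set.range (b.map (LinearEquiv.transvection hw))) =
      Submodule.span ℤ (Set.range b) := by
  have key : ∀ j, b.map (LinearEquiv.transvection hw) j = b j + b.coord i (b j) • w := fun j => rfl
  have hi : b.map (LinearEquiv.transvection hw) i = b i + w := by simp [key]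
  have hj : ∀ j, j ≠ i → b.map (LinearEquiv.transvection hw) j = b j := fun j hj => by
    simp [key, Finsupp.single_eq_of_ne hj.symm]
  apply le_antisymm
  · rw [Submodule.span_le]
    rintro _ ⟨j, rfl⟩
    by_cases h : j = i
    · subst h
      rw [hi]
      exact add_mem (Submodule.subset_span ⟨j, rfl⟩) hwL
    · rw [hj j h]
      exact Submodule.subset_span ⟨j, rfl⟩
  · have hw' : w ∈ Submodule.span ℤ (Set.range (b.map (LinearEquiv.transvection hw))) := by
      have hmem : ∑ j, b.repr w j • b j ∈
          Submodule.span ℤ (Set.range (b.map (LinearEquiv.transvection hw))) := ?_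
      · rwa [b.sum_repr w] at hmem
      refine Submodule.sum_mem _ fun j _ => ?_
      by_cases h : j = i
      · subst h
        have : b.repr w j = 0 := hw
        rw [this, zero_smul]
        exact zero_mem _
      · obtain ⟨z, hz⟩ := (mem_span_int_iff b w).mp hwL j
        rw [hz, Int.cast_smul_eq_zsmul]
        exact Submodule.smul_mem _ _ (Submodule.subset_span ⟨j, hj j h⟩)
    rw [Submodule.span_le]
    rintro _ ⟨j, rfl⟩
    by_cases h : j = i
    · subst h
      have : b j = b.map (LinearEquiv.transvection hw) j - w := by rw [hi]; abel
      rw [this]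
      exact sub_mem (Submodule.subset_span ⟨j, rfl⟩) hw'
    · rw [← hj j h]
      exact Submodule.subset_span ⟨j, rfl⟩

/-- Among the bases of an integral lattice there is one of minimal trace; no basis vector can be
shortened by adding a combination of the others. -/
theorem exists_minimal_basis {Q : QuadraticForm ℚ V} (hQ : Q.PosDef) {L : Submodule ℤ V}
    (hint : ∀ x ∈ L, ∃ m : ℤ, Q x = m) (b₀ : Module.Basis ι ℚ V)
    (hb₀ : L = Submodule.span ℤ (Set.range b₀)) :
    ∃ b : Module.Basis ι ℚ V, L = Submodule.span ℤ (Set.range b) ∧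
      ∀ i, ∀ w ∈ L, b.coord i w = 0 → Q (b i) ≤ Q (b i + w) := by
  let S : Set (Module.Basis ι ℚ V) := {b | L = Submodule.span ℤ (Set.range b)}
  let f : Module.Basis ι ℚ V → ℕ := fun b => ⌊∑ i, Q (b i)⌋₊
  have hf : ∀ b ∈ S, (f b : ℚ) = ∑ i, Q (b i) := by
    intro b hb
    choose m hm using fun i => hint (b i) (hb ▸ Submodule.subset_span ⟨i, rfl⟩)
    have h0 : 0 ≤ ∑ i, Q (b i) := Finset.sum_nonneg fun i _ => hQ.nonneg _
    simp only [f]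
    simp only [hm] at h0 ⊢
    rw [← Int.cast_sum] at h0 ⊢
    lift ∑ i, m i to ℕ using (by exact_mod_cast h0) with k
    simp
  obtain ⟨b, hb, hmin⟩ : ∃ b ∈ S, ∀ c ∈ S, f b ≤ f c := by
    have hne : (f '' S).Nonempty := ⟨_, b₀, hb₀, rfl⟩
    obtain ⟨b, hb, hbf⟩ := Nat.sInf_mem hne
    exact ⟨b, hb, fun c hc => hbf ▸ Nat.sInf_le ⟨c, hc, rfl⟩⟩
  refine ⟨b, hb, fun i w hwL hw => ?_⟩
  have hb' : L = Submodule.span ℤ (Set.range b) := hb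
  have hc : b.map (LinearEquiv.transvection hw) ∈ S := by
    change L = _
    rw [span_map_transvection b i hw (hb' ▸ hwL), ← hb']
  have h1 : (f b : ℚ) ≤ f (b.map (LinearEquiv.transvection hw)) := by exact_mod_cast hmin _ hc
  have key : ∀ j, b.map (LinearEquiv.transvection hw) j = b j + b.coord i (b j) • w := fun j => rfl
  rw [hf b hb, hf _ hc, ← Finset.add_sum_erase _ _ (Finset.mem_univ i),
    ← Finset.add_sum_erase Finset.univ (fun j => Q (b.map _ j)) (Finset.mem_univ i)] at h1
  have h2 : ∑ j ∈ Finset.univ.erase i, Q (b.map (LinearEquiv.transvection hw) j) =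
      ∑ j ∈ Finset.univ.erase i, Q (b j) := by
    refine Finset.sum_congr rfl fun j hj => ?_
    rw [key]
    simp [Finsupp.single_eq_of_ne (Finset.ne_of_mem_erase hj).symm]
  have h3 : b.coord i (b i) = 1 := by simp
  rw [h2, key, h3, one_smul] at h1
  exact le_of_add_le_add_right h1

/-- The sign choices `e`, `d` turn the last three terms into `-|s| - |t| - |r|`, which is possible
because `r s t < 0`. -/
theorem abs_add_abs_add_abs_le {B r s t : ℚ} (h : r * s * t < 0)
    (H : ∀ e d : ℤ, e * e = 1 → d * d = 1 → 0 ≤ B + e * s + d * t + e * d * r) :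
    |r| + |s| + |t| ≤ B := by
  have h1 := H 1 1 rfl rfl
  have h2 := H 1 (-1) rfl rfl
  have h3 := H (-1) 1 rfl rfl
  have h4 := H (-1) (-1) rfl rfl
  push_cast at h1 h2 h3 h4
  rcases abs_cases r with ⟨hr, hr'⟩ | ⟨hr, hr'⟩ <;>
  rcases abs_cases s with ⟨hs, hs'⟩ | ⟨hs, hs'⟩ <;>
  rcases abs_cases t with ⟨ht, ht'⟩ | ⟨ht, ht'⟩ <;> rw [hr, hs, ht]
  · exact absurd h (not_lt.mpr (mul_nonneg (mul_nonneg hr' hs') ht'))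
  · linarith
  · linarith
  · exact absurd h (not_lt.mpr (mul_nonneg_of_nonpos_of_nonpos
      (mul_nonpos_of_nonneg_of_nonpos hr' hs'.le) ht'.le))
  · linarith
  · exact absurd h (not_lt.mpr (mul_nonneg_of_nonpos_of_nonpos
      (mul_nonpos_of_nonpos_of_nonneg hr'.le hs') ht'.le))
  · exact absurd h (not_lt.mpr (mul_nonneg (mul_nonneg_of_nonpos_of_nonpos hr'.le hs'.le) ht'))
  · linarith

theorem exists_int_polar_eq {Q : QuadraticForm ℚ V} {L : Submodule ℤ V}
    (hint : ∀ x ∈ L, ∃ m : ℤ, Q x = m) {x y : V} (hx : x ∈ L) (hy : y ∈ L) :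
    ∃ z : ℤ, QuadraticMap.polar Q x y = z := by
  obtain ⟨k, hk⟩ := hint _ (add_mem hx hy)
  obtain ⟨l, hl⟩ := hint _ hx
  obtain ⟨m, hm⟩ := hint _ hy
  refine ⟨k - l - m, ?_⟩
  rw [QuadraticMap.polar, hk, hl, hm]
  push_cast
  ring

/-- A basis of minimal trace, ordered by length, is reduced; hence its Gram matrix is bounded by
its determinant. -/
theorem exists_bounded_basis (hV : Module.finrank ℚ V = 3) {Q : QuadraticForm ℚ V} (hQ : Q.PosDef)
    {L : Submodule ℤ V} (hL : IsIntegralLattice Q L) :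
    ∃ b : Module.Basis (Fin 3) ℚ V, L = Submodule.span ℤ (Set.range b) ∧
      ∀ i j, ∃ z : ℤ, |(z : ℚ)| ≤ (gram Q b).det ∧ gram Q b i j = z := by
  obtain ⟨b₀, hb₀⟩ := exists_basis_span_eq hV L hL.isLattice
  obtain ⟨b₁, hb₁, hmin₁⟩ := exists_minimal_basis hQ hL.integral b₀ hb₀
  let σ := Tuple.sort (fun i => Q (b₁ i))
  have hmono : Monotone (fun i => Q (b₁ (σ i))) := Tuple.monotone_sort (fun i => Q (b₁ i))
  obtain ⟨b, hb, hbL⟩ : ∃ b : Module.Basis (Fin 3) ℚ V, (∀ i, b i = b₁ (σ i)) ∧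
      ∀ i x, b.coord i x = b₁.coord (σ i) x :=
    ⟨b₁.reindex σ.symm, fun i => by simp, fun i x => by simp [Module.Basis.repr_reindex]⟩
  have hspan : L = Submodule.span ℤ (Set.range b) := by
    rw [hb₁]
    congr 1
    ext x
    constructor
    · rintro ⟨i, rfl⟩; exact ⟨σ.symm i, by rw [hb, Equiv.apply_symm_apply]⟩
    · rintro ⟨i, rfl⟩; exact ⟨σ i, (hb i).symm⟩
  have hmem : ∀ i, b i ∈ L := fun i => hspan ▸ Submodule.subset_span ⟨i, rfl⟩
  have hmin : ∀ i, ∀ w ∈ L, b.coord i w = 0 → Q (b i) ≤ Q (b i + w) := fun i w hw h => by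
    rw [hb i]
    exact hmin₁ (σ i) w hw (by rw [← hbL, h])
  have hle : ∀ i j, i ≤ j → Q (b i) ≤ Q (b j) := fun i j hij => by
    rw [hb, hb]; exact hmono hij
  have hone : ∀ i, 1 ≤ Q (b i) := fun i => by
    obtain ⟨m, hm⟩ := hL.integral _ (hmem i)
    have := hQ (b i) (b.ne_zero i)
    rw [hm] at this ⊢
    have h1 : 0 < m := by exact_mod_cast this
    exact_mod_cast h1
  have hpair : ∀ i j, i ≠ j → |QuadraticMap.polar Q (b j) (b i)| ≤ Q (b j) := by
    intro i j hij
    have hc : ∀ e : ℤ, b.coord i (e • b j) = 0 := fun e => by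
      rw [map_zsmul, Module.Basis.coord_apply, Module.Basis.repr_self,
        Finsupp.single_eq_of_ne hij, smul_zero]
    have key : ∀ e : ℤ, Q (b i) ≤ Q (b i) + e * e * Q (b j) +
        e * QuadraticMap.polar Q (b j) (b i) := fun e => by
      have := hmin i (e • b j) (L.smul_mem e (hmem j)) (hc e)
      rwa [← Int.cast_smul_eq_zsmul ℚ e (b j), quadraticForm_add_smul] at this
    have h1 := key 1
    have h2 := key (-1)
    push_cast at h1 h2
    rw [abs_le]
    constructor <;> linarith
  have h01 := hpair 1 0 (by decide)
  have h02 := hpair 2 0 (by decide)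
  have h12 := hpair 2 1 (by decide)
  set a := Q (b 0) with ha
  set β := Q (b 1) with hβ
  set c := Q (b 2) with hc
  set r := QuadraticMap.polar Q (b 0) (b 1) with hr
  set s := QuadraticMap.polar Q (b 0) (b 2) with hs
  set t := QuadraticMap.polar Q (b 1) (b 2) with ht
  -- minimality of the longest vector against all `±b 0 ± b 1`
  have htriple : ∀ e d : ℤ, e * e = 1 → d * d = 1 → 0 ≤ a + β + e * s + d * t + e * d * r := by
    intro e d he hd
    have h1 := hmin 2 (e • b 0 + d • b 1)
      (add_mem (L.smul_mem e (hmem 0)) (L.smul_mem d (hmem 1))) (by simp)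
    rw [← Int.cast_smul_eq_zsmul ℚ e (b 0), ← Int.cast_smul_eq_zsmul ℚ d (b 1), ← add_assoc,
      quadraticForm_add_smul, quadraticForm_add_smul, QuadraticMap.polar_add_right,
      QuadraticMap.polar_smul_right, QuadraticMap.polar_comm Q (b 1) (b 0), ← ha, ← hβ, ← hc,
      ← hr, ← hs, ← ht, smul_eq_mul] at h1
    have he' : (e : ℚ) * e = 1 := by exact_mod_cast he
    have hd' : (d : ℚ) * d = 1 := by exact_mod_cast hd
    rw [he', hd'] at h1
    linarith
  have hneg : r * s * t < 0 → |r| + |s| + |t| ≤ a + β := by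
    intro h
    exact abs_add_abs_add_abs_le h htriple
  have ha1 : 1 ≤ a := hone 0
  have hb1 : 1 ≤ β := hone 1
  have hc1 : 1 ≤ c := hone 2
  have hab : a ≤ β := hle 0 1 (by decide)
  have hbc : β ≤ c := hle 1 2 (by decide)
  have hbound := reduced_det_bound (by linarith) hab hbc h01 h02 h12 hneg
  have hdet : (gram Q b).det =
      2 * (4 * (a * β * c) + r * s * t - a * t ^ 2 - β * s ^ 2 - c * r ^ 2) := by
    rw [Matrix.det_fin_three]
    simp only [gram_apply, QuadraticMap.polar_self]
    rw [QuadraticMap.polar_comm Q (b 1) (b 0), QuadraticMap.polar_comm Q (b 2) (b 0),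
      QuadraticMap.polar_comm Q (b 2) (b 1), ← ha, ← hβ, ← hc, ← hr, ← hs, ← ht]
    simp only [nsmul_eq_mul]
    push_cast
    ring
  have hcD : 2 * c ≤ (gram Q b).det := by
    have h1 : 1 * c ≤ (a * β) * c := by
      have : 1 ≤ a * β := one_le_mul_of_one_le_of_one_le ha1 hb1
      gcongr
    rw [hdet]
    linarith
  have hQle : ∀ i, Q (b i) ≤ c := fun i => hle i 2 (Fin.le_last i)
  refine ⟨b, hspan, fun i j => ?_⟩
  obtain ⟨z, hz⟩ := exists_int_polar_eq hL.integral (hmem i) (hmem j)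
  rw [gram_apply]
  refine ⟨z, ?_, hz⟩
  rw [← hz]
  by_cases hij : i = j
  · subst hij
    rw [QuadraticMap.polar_self, two_nsmul, abs_of_nonneg (by linarith [hone i])]
    linarith [hQle i]
  · exact (hpair j i (Ne.symm hij)).trans (by linarith [hQle i])

theorem isometry_of_gram_eq {Q : QuadraticForm ℚ V}
    {b c : Module.Basis ι ℚ V} (h : gram Q b = gram Q c) :
    ∃ σ ∈ orthGroup Q, mapLattice σ (Submodule.span ℤ (Set.range b)) =
      Submodule.span ℤ (Set.range c) := by
  let σ : V ≃ₗ[ℚ] V := b.equiv c (Equiv.refl ι)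
  have hσ : ∀ i, σ (b i) = c i := fun i => by simp [σ]
  refine ⟨σ, fun x => ?_, ?_⟩
  · have h1 : Q.polarBilin.compl₁₂ σ.toLinearMap σ.toLinearMap = Q.polarBilin := by
      refine LinearMap.BilinForm.ext_basis b fun i j => ?_
      have h2 : gram Q b i j = gram Q c i j := by rw [h]
      rw [gram_apply, gram_apply] at h2
      simp only [LinearMap.compl₁₂_apply, LinearEquiv.coe_coe, hσ,
        QuadraticMap.polarBilin_apply_apply, h2]
    have h2 := congrArg (fun B : LinearMap.BilinForm ℚ V => B x x) h1
    simp only [LinearMap.compl₁₂_apply, LinearEquiv.coe_coe,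
      QuadraticMap.polarBilin_apply_apply, QuadraticMap.polar_self, two_nsmul] at h2
    linarith
  · rw [mapLattice, Submodule.map_span, ← Set.range_comp]
    congr 2
    funext i
    exact hσ i

/-! ### The number of spinor genera -/

section Count

variable [FiniteDimensional ℚ V] {Q : QuadraticForm ℚ V} {L : Submodule ℤ V}

/-- Lattices in the genus of an integral lattice are integral. -/
theorem integral_glue (hL : IsIntegralLattice Q L) (g : adelicOrthGroup Q) :
    IsIntegralLattice Q (glue g.1 L) where
  isLattice := glue_isLattice hL.isLattice g
  integral x hx := by
    refine exists_int_eq_of_norm_le_one fun p => ?_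
    -- `Q` is integral on `L_p`; its polar form has to be treated first, as `Q` is not additive
    have key : ∀ y ∈ localLattice p L, ‖localForm p Q y‖ ≤ 1 := by
      have hpol : ∀ x ∈ localLattice p L, ∀ y ∈ localLattice p L,
          ‖QuadraticMap.polar (localForm p Q) x y‖ ≤ 1 := by
        intro x hx y hy
        induction hx, hy using Submodule.span_induction₂ with
        | mem_mem x y hx hy =>
          obtain ⟨x, hx, rfl⟩ := hx
          obtain ⟨y, hy, rfl⟩ := hy
          obtain ⟨z, hz⟩ := exists_int_polar_eq hL.integral hx hy
          rw [polar_tmul, hz, Rat.cast_intCast]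
          exact Padic.norm_int_le_one z
        | zero_left y hy => simp
        | zero_right x hx => simp
        | add_left x y z _ _ _ h1 h2 =>
          rw [QuadraticMap.polar_add_left]
          exact (Padic.nonarchimedean _ _).trans (max_le h1 h2)
        | add_right x y z _ _ _ h1 h2 =>
          rw [QuadraticMap.polar_add_right]
          exact (Padic.nonarchimedean _ _).trans (max_le h1 h2)
        | smul_left r x y _ _ h =>
          rw [← algebraMap_smul ℚ_[p] r x, QuadraticMap.polar_smul_left, smul_eq_mul, norm_mul]
          exact mul_le_one₀ r.2 (norm_nonneg _) h
        | smul_right r x y _ _ h =>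
          rw [← algebraMap_smul ℚ_[p] r y, QuadraticMap.polar_smul_right, smul_eq_mul,
            norm_mul]
          exact mul_le_one₀ r.2 (norm_nonneg _) h
      intro y hy
      induction hy using Submodule.span_induction with
      | mem y hy =>
        obtain ⟨x, hx, rfl⟩ := hy
        obtain ⟨z, hz⟩ := hL.integral x hx
        rw [QuadraticForm.baseChange_tmul, hz]
        simpa [Algebra.smul_def] using Padic.norm_int_le_one (p := p) z
      | zero => simp
      | add x y hx hy h1 h2 =>
        rw [QuadraticMap.map_add (localForm p Q)]
        exact (Padic.nonarchimedean _ _).trans (max_le ((Padic.nonarchimedean _ _).trans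
          (max_le h1 h2)) (hpol x hx y hy))
      | smul r x hx h =>
        rw [← algebraMap_smul ℚ_[p] r x, QuadraticMap.map_smul, smul_eq_mul, norm_mul, norm_mul]
        exact mul_le_one₀ (mul_le_one₀ r.2 (norm_nonneg _) r.2) (norm_nonneg _) h
    have h1 := key _ (hx p)
    rw [(inv_mem (g.2.1 p) : _ ∈ orthGroup (localForm p Q)) _, QuadraticForm.baseChange_tmul] at h1
    simpa [Algebra.smul_def] using h1

theorem exists_glue_of_mem_spn (hL : Submodule.IsLattice ℚ L) (h : adelicOrthGroup Q)
    {X : Submodule ℤ V} (hX : X ∈ spn Q (glue h.1 L)) :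
    ∃ x : adelicOrthGroup Q, X = glue x.1 L := by
  obtain ⟨hlat, σ, hσ, H⟩ := mem_spn_iff_of_locSet.mp hX
  choose S hS H using H
  rw [← mem_gen_iff hL]
  refine mem_gen_of_locSet hlat fun p => ⟨globalAut σ p * S p * h.1 p, mul_mem (mul_mem
    (globalAut_mem_orthGroup hσ p) (spinorGroup_le_orthGroup _ (hS p))) (h.2.1 p), ?_⟩
  rw [H p, glue_locSet hL, mul_smul, mul_smul]

/-- The subgroup `O(V) O'_A(V) O_A(L)`, whose cosets are the spinor genera in the genus of `L`. -/
noncomputable abbrev spinorClassGroup (Q : QuadraticForm ℚ V) (L : Submodule ℤ V) :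
    Subgroup (adelicOrthGroup Q) :=
  globalSubgroup Q ⊔ spinorSubgroup Q ⊔ latticeStabilizer Q L

theorem spn_glue_eq_iff (hQ : Q.PosDef) (hL : Submodule.IsLattice ℚ L) (g h : adelicOrthGroup Q) :
    spn Q (glue g.1 L) = spn Q (glue h.1 L) ↔ g⁻¹ * h ∈ spinorClassGroup Q L := by
  constructor
  · intro H
    rw [← glue_mem_spn_iff hQ hL, H, glue_mem_spn_iff hQ hL, inv_mul_cancel]
    exact one_mem _
  · intro H
    have key : ∀ g h : adelicOrthGroup Q, g⁻¹ * h ∈ spinorClassGroup Q L →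
        spn Q (glue g.1 L) ⊆ spn Q (glue h.1 L) := by
      intro g h H X hX
      obtain ⟨x, rfl⟩ := exists_glue_of_mem_spn hL g hX
      rw [glue_mem_spn_iff hQ hL] at hX ⊢
      have := mul_mem (inv_mem H) hX
      rwa [mul_inv_rev, inv_inv, mul_assoc, mul_inv_cancel_left] at this
    refine Set.Subset.antisymm (key g h H) (key h g ?_)
    simpa using inv_mem H

/-- There are finitely many spinor genera in the genus of an integral ternary lattice, since there
are finitely many classes: each is determined by the Gram matrix of a reduced basis, an integral
matrix bounded by the common determinant of the genus. -/
theorem finite_genS (hV : Module.finrank ℚ V = 3) (hQ : Q.PosDef) (hL : IsIntegralLattice Q L) :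
    (genS Q L).Finite := by
  obtain ⟨b₀, hb₀⟩ := exists_basis_span_eq hV L hL.isLattice
  set D := (gram Q b₀).det
  let T : Set (Matrix (Fin 3) (Fin 3) ℚ) := {G | ∀ i j, ∃ z : ℤ, |(z : ℚ)| ≤ D ∧ G i j = z}
  have hT : T.Finite := by
    have h1 : {q : ℚ | ∃ z : ℤ, |(z : ℚ)| ≤ D ∧ q = z}.Finite := by
      refine ((Set.finite_Icc (-⌊D⌋) ⌊D⌋).image (Int.cast : ℤ → ℚ)).subset ?_
      rintro _ ⟨z, hz, rfl⟩
      refine ⟨z, abs_le.mp (Int.le_floor.mpr ?_), rfl⟩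
      exact_mod_cast hz
    exact Set.Finite.pi' fun i => Set.Finite.pi' fun j => h1
  let F : Matrix (Fin 3) (Fin 3) ℚ → Set (Set (Submodule ℤ V)) := fun G =>
    {S | ∃ g : adelicOrthGroup Q, ∃ b : Module.Basis (Fin 3) ℚ V,
      glue g.1 L = Submodule.span ℤ (Set.range b) ∧ gram Q b = G ∧ S = spn Q (glue g.1 L)}
  have hF : ∀ G, (F G).Subsingleton := by
    rintro G _ ⟨g, b, hb, hG, rfl⟩ _ ⟨h, c, hc, hG', rfl⟩
    obtain ⟨σ, hσ, hmap⟩ := isometry_of_gram_eq (hG.trans hG'.symm)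
    set o : adelicOrthGroup Q := ⟨globalAut σ, globalAut_mem_adelicOrthGroup hσ⟩
    have ho : o ∈ globalSubgroup Q := ⟨σ, hσ, fun _ => rfl⟩
    have h1 : glue (o * g).1 L = glue h.1 L := by
      rw [glue_globalAut_mul hL.isLattice g (fun p => rfl), hb, hmap, hc]
    rw [← h1, spn_glue_eq_iff hQ hL.isLattice]
    have hn : (spinorClassGroup Q L).Normal :=
      normal_of_commutator_mem (commutator_mem_spinorSubgroup hQ) (le_sup_right.trans le_sup_left)
    have := hn.conj_mem o (Subgroup.mem_sup_left (Subgroup.mem_sup_left ho)) g⁻¹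
    rwa [inv_inv, mul_assoc] at this
  refine (hT.biUnion fun G _ => (hF G).finite).subset ?_
  rintro _ ⟨K, hK, rfl⟩
  obtain ⟨g, rfl⟩ := (mem_gen_iff hL.isLattice).mp hK
  obtain ⟨b, hb, hbound⟩ := exists_bounded_basis hV hQ (integral_glue hL g)
  have hD : (gram Q b).det = D := det_gram_glue hQ b₀ b g (by rw [← hb₀, hb])
  rw [hD] at hbound
  exact Set.mem_biUnion (x := gram Q b) hbound ⟨g, b, hb, rfl, rfl⟩

theorem index_spinorClassGroup (hQ : Q.PosDef) (hL : Submodule.IsLattice ℚ L) :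
    (spinorClassGroup Q L).index = (genS Q L).ncard := by
  let f : adelicOrthGroup Q → genS Q L := fun g =>
    ⟨spn Q (glue g.1 L), glue g.1 L, (mem_gen_iff hL).mpr ⟨g, rfl⟩, rfl⟩
  have hf : ∀ g h, f g = f h ↔ g⁻¹ * h ∈ spinorClassGroup Q L := fun g h => by
    rw [← spn_glue_eq_iff hQ hL]
    exact Subtype.mk_eq_mk
  have hinj : Function.Injective (Quotient.lift f fun g h hgh =>
      (hf g h).mpr (QuotientGroup.leftRel_apply.mp hgh)) := by
    rintro ⟨g⟩ ⟨h⟩ hgh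
    exact QuotientGroup.eq.mpr ((hf g h).mp hgh)
  have hsurj : Function.Surjective (Quotient.lift f fun g h hgh =>
      (hf g h).mpr (QuotientGroup.leftRel_apply.mp hgh)) := by
    rintro ⟨_, K, hK, rfl⟩
    obtain ⟨g, rfl⟩ := (mem_gen_iff hL).mp hK
    exact ⟨(g : adelicOrthGroup Q ⧸ spinorClassGroup Q L), rfl⟩
  exact Nat.card_congr (Equiv.ofBijective _ ⟨hinj, hsurj⟩)

end Count

end SpinorGenus

/-! ### Similitudes -/

namespace SpinorGenus

open Filter
open scoped Pointwise

section Similitude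

variable {K : Type*} [Field K] {U U' : Type*} [AddCommGroup U] [Module K U] [AddCommGroup U']
  [Module K U'] {Q : QuadraticForm K U} {Q' : QuadraticForm K U'}

/-- The conjugate `e σ e⁻¹` of an automorphism by a linear equivalence. -/
def conjAut (e : U ≃ₗ[K] U') (σ : U ≃ₗ[K] U) : U' ≃ₗ[K] U' := e.symm.trans (σ.trans e)

theorem conjAut_apply (e : U ≃ₗ[K] U') (σ : U ≃ₗ[K] U) (x : U) :
    conjAut e σ (e x) = e (σ x) := by
  simp [conjAut]

theorem conjAut_smul_image (e : U ≃ₗ[K] U') (σ : U ≃ₗ[K] U) (X : Set U) :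
    conjAut e σ • (e '' X) = e '' (σ • X) := by
  simp only [← Set.image_smul, ← Set.image_comp]
  exact Set.image_congr fun x _ => conjAut_apply e σ x

theorem conjAut_mem_orthGroup {e : U ≃ₗ[K] U'} {c : K} (he : ∀ x, Q' (e x) = c * Q x)
    {σ : U ≃ₗ[K] U} (hσ : σ ∈ orthGroup Q) : conjAut e σ ∈ orthGroup Q' := by
  intro y
  obtain ⟨x, rfl⟩ := e.surjective y
  rw [conjAut_apply, he, he, hσ]

/-- A similitude multiplies the spinor norm of a product of `r` symmetries by `c ^ r`, a square
when `r` is even. -/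
theorem conjAut_mem_spinorGroup {e : U ≃ₗ[K] U'} {c : K} (hc : c ≠ 0)
    (he : ∀ x, Q' (e x) = c * Q x) {σ : U ≃ₗ[K] U} (hσ : σ ∈ spinorGroup Q) :
    conjAut e σ ∈ spinorGroup Q' := by
  obtain ⟨l, h1, h2, h3, h4⟩ := hσ
  have hpol : ∀ x y, QuadraticMap.polar Q' (e x) (e y) = c * QuadraticMap.polar Q x y :=
    fun x y => by
      simp only [QuadraticMap.polar, ← map_add, he]
      ring
  have hsym : ∀ v x, Q v ≠ 0 → symmetryAt Q' (e v) (e x) = e (symmetryAt Q v x) :=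
    fun v x hv => by
      rw [symmetryAt_apply, symmetryAt_apply, he, hpol, map_sub, map_smul]
      congr 2
      field_simp
  refine ⟨l.map e, by simpa using h1, ?_, ?_, ?_⟩
  · intro v hv
    obtain ⟨w, hw, rfl⟩ := List.mem_map.mp hv
    rw [he]
    exact mul_ne_zero hc (h2 w hw)
  · have hprod : ∀ (m : List U), (∀ v ∈ m, Q v ≠ 0) → ∀ x,
        symmetryProd Q' (m.map e) (e x) = e (symmetryProd Q m x) := by
      intro m
      induction m with
      | nil => exact fun _ _ => rfl
      | cons v m ih =>
        intro hm x
        simp only [List.mem_cons, forall_eq_or_imp] at hm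
        simp only [symmetryProd, List.map_cons, List.prod_cons, Module.End.mul_apply] at ih ⊢
        rw [ih hm.2, hsym _ _ hm.1]
    ext y
    obtain ⟨x, rfl⟩ := e.surjective y
    rw [hprod l h2, h3]
    exact (conjAut_apply e σ x).symm
  · have hprod : ∀ m : List U, ((m.map e).map Q').prod = c ^ m.length * (m.map Q).prod := by
      intro m
      induction m with
      | nil => simp
      | cons v m ih =>
        simp only [List.map_cons, List.prod_cons, List.length_cons, ih, he]
        ring
    rw [hprod]
    exact (h1.isSquare_pow c).mul h4

end Similitude

variable {V : Type*} [AddCommGroup V] [Module ℚ V] {W : Type*} [AddCommGroup W] [Module ℚ W]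
variable {Q : QuadraticForm ℚ V} {Q' : QuadraticForm ℚ W} {e : V ≃ₗ[ℚ] W} {c : ℚ}

theorem mapLattice_symm_mapLattice (e : V ≃ₗ[ℚ] W) (L : Submodule ℤ V) :
    mapLattice e.symm (mapLattice e L) = L := by
  apply SetLike.coe_injective
  change e.symm '' (e '' (L : Set V)) = _
  rw [← Set.image_comp]
  simp

theorem mapLattice_mapLattice_symm (e : V ≃ₗ[ℚ] W) (L : Submodule ℤ W) :
    mapLattice e (mapLattice e.symm L) = L := by
  apply SetLike.coe_injective
  change e '' (e.symm '' (L : Set W)) = _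
  rw [← Set.image_comp]
  simp

theorem mapLattice_conjAut (e : V ≃ₗ[ℚ] W) (σ : V ≃ₗ[ℚ] V) (L : Submodule ℤ V) :
    mapLattice e (mapLattice σ L) = mapLattice (conjAut e σ) (mapLattice e L) := by
  apply SetLike.coe_injective
  change e '' (σ '' (L : Set V)) = conjAut e σ '' (e '' (L : Set V))
  simp only [← Set.image_comp]
  exact Set.image_congr fun x _ => (conjAut_apply e σ x).symm

/-- The isomorphism `V_p ≃ W_p` induced by `V ≃ W`. -/
noncomputable abbrev localEquiv (e : V ≃ₗ[ℚ] W) (p : Nat.Primes) :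
    (ℚ_[p] ⊗[ℚ] V) ≃ₗ[ℚ_[p]] (ℚ_[p] ⊗[ℚ] W) :=
  e.baseChange ℚ ℚ_[p] V W

theorem locSet_mapLattice_localEquiv (e : V ≃ₗ[ℚ] W) (L : Submodule ℤ V) (p : Nat.Primes) :
    locSet p (mapLattice e L) = localEquiv e p '' locSet p L :=
  localLattice_map e.toLinearMap L p

theorem localForm_localEquiv (he : ∀ x, Q' (e x) = c * Q x) (p : Nat.Primes)
    (x : ℚ_[p] ⊗[ℚ] V) :
    localForm p Q' (localEquiv e p x) = (c : ℚ_[p]) * localForm p Q x := by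
  have : (localForm p Q').comp (localEquiv e p).toLinearMap = (c : ℚ_[p]) • localForm p Q := by
    apply baseChange_ext
    intro m
    have h1 : localEquiv e p ((1 : ℚ_[p]) ⊗ₜ[ℚ] m) = (1 : ℚ_[p]) ⊗ₜ[ℚ] e m := rfl
    rw [QuadraticMap.comp_apply, LinearEquiv.coe_coe, h1, smul_apply,
      QuadraticForm.baseChange_tmul, QuadraticForm.baseChange_tmul, he]
    simp [Algebra.smul_def]
  exact congrArg (fun q : QuadraticForm ℚ_[p] (ℚ_[p] ⊗[ℚ] V) => q x) this

theorem conjAut_globalAut (e : V ≃ₗ[ℚ] W) (σ : V ≃ₗ[ℚ] V) (p : Nat.Primes) :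
    conjAut (localEquiv e p) (globalAut σ p) = globalAut (conjAut e σ) p :=
  localAut_ext fun x => by
    obtain ⟨y, rfl⟩ := e.surjective x
    have h1 : (1 : ℚ_[p]) ⊗ₜ[ℚ] e y = localEquiv e p ((1 : ℚ_[p]) ⊗ₜ[ℚ] y) := rfl
    rw [globalAut_tmul, conjAut_apply, h1, conjAut_apply]
    rfl

theorem mapLattice_mem_gen (he : ∀ x, Q' (e x) = c * Q x) {L K : Submodule ℤ V}
    (h : K ∈ gen Q L) : mapLattice e K ∈ gen Q' (mapLattice e L) := by
  obtain ⟨hK, H⟩ := h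
  refine mem_gen_of_locSet (isLattice_mapLattice e hK) fun p => ?_
  obtain ⟨S, hS⟩ := H p
  refine ⟨conjAut (localEquiv e p) S.toLinearEquiv,
    conjAut_mem_orthGroup (localForm_localEquiv he p) fun x => S.map_app x, ?_⟩
  rw [locSet_mapLattice_localEquiv, locSet_mapLattice_localEquiv, conjAut_smul_image]
  exact congrArg _ hS

theorem mapLattice_mem_spn (hc : c ≠ 0) (he : ∀ x, Q' (e x) = c * Q x) {L K : Submodule ℤ V}
    (h : K ∈ spn Q L) : mapLattice e K ∈ spn Q' (mapLattice e L) := by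
  rw [mem_spn_iff_of_locSet] at h ⊢
  obtain ⟨hK, σ, hσ, H⟩ := h
  refine ⟨isLattice_mapLattice e hK, conjAut e σ, conjAut_mem_orthGroup he hσ, fun p => ?_⟩
  obtain ⟨S, hS, H⟩ := H p
  refine ⟨conjAut (localEquiv e p) S, conjAut_mem_spinorGroup (c := (c : ℚ_[p]))
    (Rat.cast_ne_zero.mpr hc) (localForm_localEquiv he p) hS, ?_⟩
  rw [locSet_mapLattice_localEquiv, locSet_mapLattice_localEquiv, conjAut_smul_image,
    ← conjAut_globalAut, conjAut_smul_image, H]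

theorem mapLattice_mem_cls (he : ∀ x, Q' (e x) = c * Q x) {L K : Submodule ℤ V}
    (h : K ∈ cls Q L) : mapLattice e K ∈ cls Q' (mapLattice e L) := by
  rw [mem_cls_iff] at h ⊢
  obtain ⟨σ, hσ, rfl⟩ := h
  exact ⟨conjAut e σ, conjAut_mem_orthGroup he hσ, mapLattice_conjAut e σ L⟩

theorem symm_similitude (hc : c ≠ 0) (he : ∀ x, Q' (e x) = c * Q x) (y : W) :
    Q (e.symm y) = c⁻¹ * Q' y := by
  obtain ⟨x, rfl⟩ := e.surjective y
  rw [he, e.symm_apply_apply, inv_mul_cancel_left₀ hc]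

theorem mapLattice_mem_spn_iff (hc : c ≠ 0) (he : ∀ x, Q' (e x) = c * Q x)
    {L K : Submodule ℤ V} : mapLattice e K ∈ spn Q' (mapLattice e L) ↔ K ∈ spn Q L := by
  refine ⟨fun h => ?_, mapLattice_mem_spn hc he⟩
  have := mapLattice_mem_spn (inv_ne_zero hc) (symm_similitude hc he) h
  rwa [mapLattice_symm_mapLattice, mapLattice_symm_mapLattice] at this

theorem spn_mapLattice (hc : c ≠ 0) (he : ∀ x, Q' (e x) = c * Q x) (L : Submodule ℤ V) :
    spn Q' (mapLattice e L) = mapLattice e '' spn Q L := by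
  ext X
  constructor
  · intro h
    refine ⟨mapLattice e.symm X, ?_, mapLattice_mapLattice_symm e X⟩
    rwa [← mapLattice_mem_spn_iff hc he, mapLattice_mapLattice_symm]
  · rintro ⟨K, hK, rfl⟩
    exact mapLattice_mem_spn hc he hK

theorem gen_mapLattice (hc : c ≠ 0) (he : ∀ x, Q' (e x) = c * Q x) (L : Submodule ℤ V) :
    gen Q' (mapLattice e L) = mapLattice e '' gen Q L := by
  ext X
  constructor
  · intro h
    refine ⟨mapLattice e.symm X, ?_, mapLattice_mapLattice_symm e X⟩
    have := mapLattice_mem_gen (symm_similitude hc he) h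
    rwa [mapLattice_symm_mapLattice] at this
  · rintro ⟨K, hK, rfl⟩
    exact mapLattice_mem_gen he hK

theorem numSpinorGenera_mapLattice (hc : c ≠ 0) (he : ∀ x, Q' (e x) = c * Q x)
    (L : Submodule ℤ V) : numSpinorGenera Q' (mapLattice e L) = numSpinorGenera Q L := by
  have hinj : Function.Injective (mapLattice e) :=
    Function.LeftInverse.injective (g := mapLattice e.symm) (mapLattice_symm_mapLattice e)
  have : genS Q' (mapLattice e L) = Set.image (mapLattice e) '' genS Q L := by
    rw [genS, genS, gen_mapLattice hc he, ← Set.image_comp, ← Set.image_comp]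
    exact Set.image_congr fun K _ => spn_mapLattice hc he K
  rw [numSpinorGenera, numSpinorGenera, this, hinj.image_injective.encard_image]

/-! ### Construction of the correspondence -/

theorem mem_cls_self (Q : QuadraticForm ℚ V) (L : Submodule ℤ V) : L ∈ cls Q L :=
  mem_cls_iff.mpr ⟨1, one_mem _, by simp [mapLattice]⟩

theorem cls_mapLattice {σ : V ≃ₗ[ℚ] V} (hσ : σ ∈ orthGroup Q) (L : Submodule ℤ V) :
    cls Q (mapLattice σ L) = cls Q L := by
  have hmul : ∀ (σ τ : V ≃ₗ[ℚ] V) (L : Submodule ℤ V),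
      mapLattice σ (mapLattice τ L) = mapLattice (σ * τ) L := fun σ τ L => by
    apply SetLike.coe_injective
    change σ '' (τ '' (L : Set V)) = (σ * τ : V ≃ₗ[ℚ] V) '' (L : Set V)
    rw [← Set.image_comp]
    rfl
  ext K
  rw [mem_cls_iff, mem_cls_iff]
  constructor
  · rintro ⟨τ, hτ, rfl⟩
    exact ⟨τ * σ, mul_mem hτ hσ, hmul τ σ L⟩
  · rintro ⟨τ, hτ, rfl⟩
    exact ⟨τ * σ⁻¹, mul_mem hτ (inv_mem hσ), by rw [hmul, inv_mul_cancel_right]⟩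

theorem mem_spn_iff_of_mem_cls [FiniteDimensional ℚ V] (hQ : Q.PosDef) {L : Submodule ℤ V}
    (hL : Submodule.IsLattice ℚ L) (g h : adelicOrthGroup Q) {K₁ K₂ : Submodule ℤ V}
    (h₁ : K₁ ∈ cls Q (glue g.1 L)) (h₂ : K₂ ∈ cls Q (glue h.1 L)) :
    K₁ ∈ spn Q K₂ ↔ h⁻¹ * g ∈ spinorClassGroup Q L := by
  obtain ⟨σ, hσ, rfl⟩ := mem_cls_iff.mp h₁
  obtain ⟨τ, hτ, rfl⟩ := mem_cls_iff.mp h₂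
  set s : adelicOrthGroup Q := ⟨globalAut σ, globalAut_mem_adelicOrthGroup hσ⟩
  set t : adelicOrthGroup Q := ⟨globalAut τ, globalAut_mem_adelicOrthGroup hτ⟩
  have hs : s ∈ globalSubgroup Q := ⟨σ, hσ, fun _ => rfl⟩
  have ht : t ∈ globalSubgroup Q := ⟨τ, hτ, fun _ => rfl⟩
  have hn : (spinorClassGroup Q L).Normal :=
    normal_of_commutator_mem (commutator_mem_spinorSubgroup hQ) (le_sup_right.trans le_sup_left)
  rw [← glue_globalAut_mul hL g (o := s) (fun _ => rfl),
    ← glue_globalAut_mul hL h (o := t) (fun _ => rfl), glue_mem_spn_iff hQ hL]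
  have h3 : h⁻¹ * (t⁻¹ * s) * h ∈ spinorClassGroup Q L := by
    have := hn.conj_mem (t⁻¹ * s) (Subgroup.mem_sup_left (Subgroup.mem_sup_left
      (mul_mem (inv_mem ht) hs))) h⁻¹
    rwa [inv_inv] at this
  have h4 : (t * h)⁻¹ * (s * g) = h⁻¹ * (t⁻¹ * s) * h * (h⁻¹ * g) := by group
  change (t * h)⁻¹ * (s * g) ∈ spinorClassGroup Q L ↔ _
  rw [h4]
  exact Subgroup.mul_mem_cancel_left _ h3

end SpinorGenus

open SpinorGenus in
theorem theorem4p4 {V : Type*} [AddCommGroup V] [Module ℚ V]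
    {W : Type*} [AddCommGroup W] [Module ℚ W]
    (hV : Module.finrank ℚ V = 3) (hW : Module.finrank ℚ W = 3)
    (QV : QuadraticForm ℚ V) (QW : QuadraticForm ℚ W)
    (hQV : QV.PosDef) (hQW : QW.PosDef)
    (n : ℕ) (hn : 0 < n)
    (N : Submodule ℤ W) (M : Submodule ℤ V)
    (hN : IsIntegralLattice QW N) (hM : IsIntegralLattice QV M)
    (hNM : IsRepresentablePair n QW QV N M)
    (hg : numSpinorGenera QW N = numSpinorGenera QV M) :
    ∃ C : Set (Set (Submodule ℤ W) × Set (Submodule ℤ V)),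
      IsGenusCorrespondence n QW QV N M C ∧ RespectsSpinorGenus QW QV N M C := by
  have hfV : FiniteDimensional ℚ V := Module.finite_of_finrank_eq_succ hV
  have hfW : FiniteDimensional ℚ W := Module.finite_of_finrank_eq_succ hW
  obtain ⟨φ, hφN, hφn⟩ := hNM
  have hn0 : (n : ℚ) ≠ 0 := by exact_mod_cast hn.ne'
  have hφ : ∀ x, QW (φ x) = (n : ℚ) * QV x := fun x => by
    rw [φ.map_app]; rfl
  have hinj : Function.Injective φ.toLinearMap := by
    rw [injective_iff_map_eq_zero]
    intro x hx
    by_contra hx0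
    have h1 : QW (φ x) = 0 := by
      have : φ x = 0 := hx
      rw [this, QuadraticMap.map_zero]
    rw [hφ] at h1
    exact mul_ne_zero hn0 (hQV x hx0).ne' h1
  -- `φ` identifies `W` with `V`, carrying `QW` to `n QV` and `N` to a lattice that contains `M`
  let e : V ≃ₗ[ℚ] W := LinearMap.linearEquivOfInjective φ.toLinearMap hinj (hV.trans hW.symm)
  have heφ : e.toLinearMap = φ.toLinearMap := LinearMap.ext fun x => rfl
  have he : ∀ x, QW (e x) = (n : ℚ) * QV x := hφ
  obtain ⟨N₀, rfl⟩ : ∃ N₀, N = mapLattice e N₀ := ⟨_, (mapLattice_mapLattice_symm e N).symm⟩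
  have hN₀ : Submodule.IsLattice ℚ N₀ := by
    have := isLattice_mapLattice e.symm hN.isLattice
    rwa [mapLattice_symm_mapLattice] at this
  have hrel : ∀ A B : Submodule ℤ V, (mapLattice e A).toAddSubgroup.relIndex
      (mapLattice e B).toAddSubgroup = A.toAddSubgroup.relIndex B.toAddSubgroup := fun A B =>
    AddSubgroup.relIndex_map_map_of_injective (f := e.toLinearMap.toAddMonoidHom)
      A.toAddSubgroup B.toAddSubgroup e.injective
  rw [← heφ] at hφN hφn
  have hMN : M ≤ N₀ := (Submodule.map_le_map_iff_of_injective
    (f := e.toLinearMap.restrictScalars ℤ) e.injective M N₀).mp hφN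
  have hidx : M.toAddSubgroup.relIndex N₀.toAddSubgroup = n := by rw [← hrel, hφn]
  -- the two groups of spinor genera have the same finite order
  rw [numSpinorGenera_mapLattice hn0 he] at hg
  have hfin := finite_genS hV hQV hM
  have hfin' : (genS QV N₀).Finite := by
    rw [← Set.encard_lt_top_iff]
    exact hg.trans_lt hfin.encard_lt_top
  have hcard : (genS QV N₀).ncard = (genS QV M).ncard := by
    rw [Set.ncard, Set.ncard]
    exact congrArg _ hg
  have hne : (genS QV N₀).ncard ≠ 0 := by
    refine ((Set.ncard_pos hfin').mpr ⟨_, glue 1 N₀, ?_, rfl⟩).ne'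
    exact (mem_gen_iff hN₀).mpr ⟨1, rfl⟩
  obtain ⟨X, hXN, hXM, hX⟩ := exists_compatible_representatives (globalSubgroup QV)
    (spinorSubgroup QV) (latticeStabilizer QV N₀) (latticeStabilizer QV M)
    (commutator_mem_spinorSubgroup hQV)
    (by rw [index_spinorClassGroup hQV hN₀]; exact hne)
    (by rw [index_spinorClassGroup hQV hN₀, index_spinorClassGroup hQV hM.isLattice, hcard])
  have hgenN : ∀ g : adelicOrthGroup QV, mapLattice e (glue g.1 N₀) ∈ gen QW (mapLattice e N₀) :=
    fun g => mapLattice_mem_gen he ((mem_gen_iff hN₀).mpr ⟨g, rfl⟩)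
  have hgenM : ∀ g : adelicOrthGroup QV, glue g.1 M ∈ gen QV M :=
    fun g => (mem_gen_iff hM.isLattice).mpr ⟨g, rfl⟩
  refine ⟨{x | ∃ g ∈ X, x = (cls QW (mapLattice e (glue g.1 N₀)), cls QV (glue g.1 M))},
    ⟨?_, ?_, ?_⟩, ?_⟩
  · rintro _ ⟨g, -, rfl⟩
    refine ⟨_, hgenN g, _, hgenM g, rfl, φ, ?_, ?_⟩
    · rw [← heφ]
      exact Submodule.map_mono (glue_mono hMN g.1)
    · rw [← heφ, hrel, relIndex_glue hQV hN₀ hM.isLattice hMN, hidx]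
  · intro N' hN'
    rw [gen_mapLattice hn0 he] at hN'
    obtain ⟨K, hK, rfl⟩ := hN'
    obtain ⟨g, rfl⟩ := (mem_gen_iff hN₀).mp hK
    obtain ⟨o, ⟨σ, hσ, ho⟩, s, hs, hXg⟩ := hXN g
    refine ⟨glue (o * g * s).1 M, hgenM _, o * g * s, hXg, ?_⟩
    rw [glue_mul_of_mem_stabilizer hN₀ _ hs, glue_globalAut_mul hN₀ g ho, mapLattice_conjAut,
      cls_mapLattice (conjAut_mem_orthGroup he hσ)]
  · intro M' hM'
    obtain ⟨g, rfl⟩ := (mem_gen_iff hM.isLattice).mp hM'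
    obtain ⟨o, ⟨σ, hσ, ho⟩, s, hs, hXg⟩ := hXM g
    refine ⟨mapLattice e (glue (o * g * s).1 N₀), hgenN _, o * g * s, hXg, ?_⟩
    rw [glue_mul_of_mem_stabilizer hM.isLattice _ hs, glue_globalAut_mul hM.isLattice g ho,
      cls_mapLattice hσ]
  · rintro N₁ - N₂ - M₁ - M₂ - ⟨g, hgX, h₁⟩ ⟨h, hhX, h₂⟩
    obtain ⟨hN₁, hM₁⟩ := Prod.mk.inj h₁
    obtain ⟨hN₂, hM₂⟩ := Prod.mk.inj h₂
    have hsymm := symm_similitude hn0 he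
    have hN₁' : N₁ ∈ cls QW (mapLattice e (glue g.1 N₀)) := by
      rw [← hN₁]; exact mem_cls_self QW N₁
    have hN₂' : N₂ ∈ cls QW (mapLattice e (glue h.1 N₀)) := by
      rw [← hN₂]; exact mem_cls_self QW N₂
    replace hN₁' := mapLattice_mem_cls hsymm hN₁'
    replace hN₂' := mapLattice_mem_cls hsymm hN₂'
    rw [mapLattice_symm_mapLattice] at hN₁' hN₂'
    have hM₁' : M₁ ∈ cls QV (glue g.1 M) := by
      rw [← hM₁]; exact mem_cls_self QV M₁
    have hM₂' : M₂ ∈ cls QV (glue h.1 M) := by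
      rw [← hM₂]; exact mem_cls_self QV M₂
    rw [← mapLattice_mem_spn_iff (inv_ne_zero hn0) hsymm,
      mem_spn_iff_of_mem_cls hQV hN₀ g h hN₁' hN₂',
      mem_spn_iff_of_mem_cls hQV hM.isLattice g h hM₁' hM₂']
    exact hX h hhX g hgX
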